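/- All rings are associative and unital. A left bialgebroid $\mathcal A_L=(A,L,s_L,t_L,\gamma_L,\pi_L)$ consists of rings $A,L$, ring homomorphisms $s_L:L\to A$, $t_L:L^{op}\to A$ with commuting images, and additive maps $\gamma_L:A\to A_L\otimes{}_LA$ and $\pi_L:A\to L$ making $A$, with $l\cdot a\cdot l'=s_L(l)t_L(l')a$, a comonoid in $L$-$L$-bimodules, such that, with $\gamma_L(a)=a_{(1)}\otimes a_{(2)}$, one has $a_{(1)}t_L(l)\otimes a_{(2)}=a_{(1)}\otimes a_{(2)}s_L(l)$, $\gamma_L(1)=1\otimes 1$, $\gamma_L(ab)=\gamma_L(a)\gamma_L(b)$, $\pi_L(1)=1$ and $\pi_L(a\,s_L\pi_L(b))=\pi_L(ab)=\pi_L(a\,t_L\pi_L(b))$. Here $A_L\otimes{}_LA$ is the quotient of $A\otimes_{\mathbb Z}A$ by $t_L(l)a\otimes b=a\otimes s_L(l)b$. A right bialgebroid $\mathcal A_R=(A,R,s_R,t_R,\gamma_R,\pi_R)$ consists of ring homomorphisms $s_R:R\to A$, $t_R:R^{op}\to A$ with commuting images and a comonoid structure $\gamma_R(a)=a^{(1)}\otimes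 a^{(2)}\in A^R\otimes{}^RA$, $\pi_R:A\to R$ on $A$ in $R$-$R$-bimodules for $r\cdot a\cdot r'=a\,s_R(r')t_R(r)$, such that $s_R(r)a^{(1)}\otimes a^{(2)}=a^{(1)}\otimes t_R(r)a^{(2)}$, $\gamma_R$ is unital and multiplicative, $\pi_R(1)=1$ and $\pi_R(s_R\pi_R(a)\,b)=\pi_R(ab)=\pi_R(t_R\pi_R(a)\,b)$. Here $A^R\otimes{}^RA$ is the quotient of $A\otimes_{\mathbb Z}A$ by $a\,s_R(r)\otimes b=a\otimes b\,t_R(r)$. Let $\mathcal A_L$ be a left bialgebroid, $R$ a ring and $\mu:L^{op}\to R$ a ring isomorphism. For an additive bijection $S:A\to A$ consider the conditions: (i) $(\mathcal A_L,S)$ is a Hopf algebroid: $S$ is an anti-automorphism of the ring $A$, $S\circ t_L=s_L$, and in $A_L\otimes{}_LA$, for all $a\in A$, $$S^{-1}(a_{(2)})_{(1')}\otimes S^{-1}(a_{(2)})_{(2')}a_{(1)}=S^{-1}(a)\otimes 1,\qquad S(a_{(1)})_{(1')}a_{(2)}\otimes S(a_{(1)})_{(2')}=1\otimes S(a).$$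 (ii) (Lu-style form) $S$ is an anti-automorphism of the ring $A$, $S\circ t_L=s_L$, $S(a_{(1)})a_{(2)}=t_L\pi_L(S(a))$ for all $a$, the map $\theta_L=\pi_L\circ S\circ s_L:L\to L$ is bijective, and, for $A^R\otimes{}^RA$ formed with $r\cdot a\cdot r'=a\,s_L(\theta_L^{-1}\mu^{-1}(r))\,t_L(\mu^{-1}(r'))$ and $S_{A\otimes_LA}:A_L\otimes{}_LA\to A^R\otimes{}^RA$, $S_{A\otimes_RA}:A^R\otimes{}^RA\to A_L\otimes{}_LA$ both given by $a\otimes b\mapsto S(b)\otimes S(a)$, one has $$S_{A\otimes_LA}\circ\gamma_L\circ S^{-1}=S_{A\otimes_RA}^{-1}\circ\gamma_L\circ S,$$ and this common map, denoted $\gamma_R$, satisfies the mixed coassociativity laws $$(\gamma_L\otimes\mathrm{id})\circ\gamma_R=(\mathrm{id}\otimes\gamma_R)\circ\gamma_L,\qquad(\gamma_R\otimes\mathrm{id})\circ\gamma_L=(\mathrm{id}\otimes\gamma_L)\circ\gamma_R. \tag{1}$$ For a right bialgebroid $\mathcal A_R$ on the same ring $A$ with base ring $R$ consider the conditions: (iii)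 (symmetric form, for $\mathcal A_R$ and an additive bijection $S$) $R\simeq L^{op}$, $s_L(L)=t_R(R)$ and $t_L(L)=s_R(R)$ as subrings of $A$, the laws (1) hold for $\gamma_L$ and $\gamma_R$, and for all $l,l'\in L$, $r,r'\in R$, $a\in A$ $$S(t_L(l)\,a\,t_L(l'))=s_L(l')S(a)s_L(l),\qquad S(t_R(r')\,a\,t_R(r))=s_R(r)S(a)s_R(r'),$$ $$S(a_{(1)})a_{(2)}=s_R\pi_R(a),\qquad a^{(1)}S(a^{(2)})=s_L\pi_L(a).$$ (iv) (Galois form, for $\mathcal A_R$) $R\simeq L^{op}$, $s_L(L)=t_R(R)$ and $t_L(L)=s_R(R)$ as subrings of $A$, the laws (1) hold for $\gamma_L$ and $\gamma_R$, and the maps $$\alpha:A^R\otimes{}_RA\to A_L\otimes{}_LA,\ a\otimes b\mapsto a_{(1)}\otimes a_{(2)}b,\qquad\beta:A_R\otimes{}^RA\to A_L\otimes{}_LA,\ a\otimes b\mapsto b_{(1)}a\otimes b_{(2)}$$ are bijective, where $a\,s_R(r)\otimes b=a\otimes s_R(r)b$ in the source of $\alpha$ and $t_R(r)a\otimes b=a\otimes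 b\,t_R(r)$ in the source of $\beta$. Then the four conditions are equivalent, in the following sense. (a) For each additive bijection $S$ of $A$, the following are equivalent: (i) holds for $S$; (ii) holds for $S$; (iii) holds for $S$ and some right bialgebroid $\mathcal A_R$ on $A$ over $R$. (b) For each right bialgebroid $\mathcal A_R$ on $A$ over $R$: (iii) holds for $\mathcal A_R$ and some additive bijection $S$ if and only if (iv) holds for $\mathcal A_R$. (c) Consequently the following are equivalent: (i) holds for some $S$; (ii) holds for some $S$; (iii) holds for some $\mathcal A_R$ and $S$; (iv) holds for some $\mathcal A_R$. (d) If (i) holds for some $S$, then $\mathcal A_L$ is a $\times_L$-Hopf algebra in the sense of Schauenburg: the map $a\otimes b\mapsto a_{(1)}\otimes a_{(2)}b$ from the quotient of $A\otimes_{\mathbb Z}A$ by $a\,t_L(l)\otimes b=a\otimes t_L(l)b$ to $A_L\otimes{}_LA$ is bijective. -/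

import Mathlib

namespace BohmSzlachanyi

section Tensor

open scoped TensorProduct

variable {I J M N P M₁ N₁ Q : Type*} [AddCommGroup M] [AddCommGroup N] [AddCommGroup P]
  [AddCommGroup M₁] [AddCommGroup N₁] [AddCommGroup Q]

/-- The subgroup of `M ⊗ N` (tensor product of abelian groups) generated by the elements
`m · i ⊗ n - m ⊗ i · n`, where `i` acts on `M` from the right through `ρ` and on `N` from the
left through `σ`. -/
def Ten.rel (ρ : I → M →+ M) (σ : I → N →+ N) : AddSubgroup (M ⊗[ℤ] N) :=
  AddSubgroup.closure {z | ∃ i m n, z = (ρ i m) ⊗ₜ[ℤ] n - m ⊗ₜ[ℤ] (σ i n)}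

/-- The tensor product `M ⊗_I N` over a (non-commutative) ring `I` of a right module `M`
(action `ρ`) and a left module `N` (action `σ`), as an abelian group. The actions are displayed
because the same group carries many module structures. -/
def Ten (ρ : I → M →+ M) (σ : I → N →+ N) : Type _ :=
  (M ⊗[ℤ] N) ⧸ Ten.rel ρ σ

instance (ρ : I → M →+ M) (σ : I → N →+ N) : AddCommGroup (Ten ρ σ) :=
  inferInstanceAs (AddCommGroup ((M ⊗[ℤ] N) ⧸ Ten.rel ρ σ))

/-- The pure tensor `m ⊗ n`. -/
def Ten.tmul (ρ : I → M →+ M) (σ : I → N →+ N) (m : M) (n : N) : Ten ρ σ :=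
  QuotientAddGroup.mk (s := Ten.rel ρ σ) (m ⊗ₜ[ℤ] n)

theorem Ten.add_tmul (ρ : I → M →+ M) (σ : I → N →+ N) (m m₁ : M) (n : N) :
    Ten.tmul ρ σ (m + m₁) n = Ten.tmul ρ σ m n + Ten.tmul ρ σ m₁ n := by
  unfold Ten.tmul
  rw [TensorProduct.add_tmul]
  rfl

theorem Ten.tmul_add (ρ : I → M →+ M) (σ : I → N →+ N) (m : M) (n n₁ : N) :
    Ten.tmul ρ σ m (n + n₁) = Ten.tmul ρ σ m n + Ten.tmul ρ σ m n₁ := by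
  unfold Ten.tmul
  rw [TensorProduct.tmul_add]
  rfl

theorem Ten.balanced (ρ : I → M →+ M) (σ : I → N →+ N) (i : I) (m : M) (n : N) :
    Ten.tmul ρ σ (ρ i m) n = Ten.tmul ρ σ m (σ i n) := by
  have h : (ρ i m) ⊗ₜ[ℤ] n - m ⊗ₜ[ℤ] (σ i n) ∈ Ten.rel ρ σ :=
    AddSubgroup.subset_closure ⟨i, m, n, rfl⟩
  have h2 := (Ten.rel ρ σ).neg_mem h
  rw [neg_sub, sub_eq_neg_add] at h2
  exact QuotientAddGroup.eq.mpr h2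

/-- Two additive maps on `M ⊗_I N` that agree on pure tensors are equal. -/
theorem Ten.hom_ext {ρ : I → M →+ M} {σ : I → N →+ N} {f g : Ten ρ σ →+ P}
    (h : ∀ m n, f (Ten.tmul ρ σ m n) = g (Ten.tmul ρ σ m n)) (z : Ten ρ σ) : f z = g z := by
  obtain ⟨w, rfl⟩ := QuotientAddGroup.mk_surjective z
  induction w using TensorProduct.induction_on with
  | zero => exact (map_zero f).trans (map_zero g).symm
  | tmul m n => exact h m n
  | add x y hx hy =>
    have e : (QuotientAddGroup.mk (s := Ten.rel ρ σ) (x + y) : Ten ρ σ) =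
      (QuotientAddGroup.mk (s := Ten.rel ρ σ) x : Ten ρ σ) +
        (QuotientAddGroup.mk (s := Ten.rel ρ σ) y : Ten ρ σ) := rfl
    exact (congrArg f e).trans ((map_add f _ _).trans
      ((congrArg₂ (· + ·) hx hy).trans ((map_add g _ _).symm.trans (congrArg g e).symm)))

/-- The additive map `m ⊗ n ↦ f m n` induced by a biadditive balanced map `f`. -/
def Ten.lift {ρ : I → M →+ M} {σ : I → N →+ N} (f : M → N → P)
    (hl : ∀ m m₁ n, f (m + m₁) n = f m n + f m₁ n)
    (hr : ∀ m n n₁, f m (n + n₁) = f m n + f m n₁)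
    (hb : ∀ i m n, f (ρ i m) n = f m (σ i n)) : Ten ρ σ →+ P :=
  QuotientAddGroup.lift (Ten.rel ρ σ)
    (TensorProduct.liftAddHom
      (AddMonoidHom.mk' (fun m => AddMonoidHom.mk' (f m) (hr m))
        (fun m m₁ => by ext n; exact hl m m₁ n))
      (fun z m n => by
        rw [map_zsmul, map_zsmul]; rfl))
    (by
      show Ten.rel ρ σ ≤ _
      unfold Ten.rel
      rw [AddSubgroup.closure_le]
      rintro _ ⟨i, m, n, rfl⟩
      simp only [SetLike.mem_coe, AddMonoidHom.mem_ker, map_sub]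
      exact sub_eq_zero.mpr (hb i m n))

@[simp] theorem Ten.lift_tmul {ρ : I → M →+ M} {σ : I → N →+ N} (f : M → N → P) (hl) (hr) (hb)
    (m : M) (n : N) : Ten.lift (ρ := ρ) (σ := σ) f hl hr hb (Ten.tmul ρ σ m n) = f m n := rfl

/-- The map `f ⊗ g` for module maps `f` and `g`. -/
def Ten.map {ρ : I → M →+ M} {σ : I → N →+ N} {ρ₁ : I → M₁ →+ M₁} {σ₁ : I → N₁ →+ N₁}
    (f : M →+ M₁) (g : N →+ N₁) (hf : ∀ i m, f (ρ i m) = ρ₁ i (f m))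
    (hg : ∀ i n, g (σ i n) = σ₁ i (g n)) : Ten ρ σ →+ Ten ρ₁ σ₁ :=
  Ten.lift (fun m n => Ten.tmul ρ₁ σ₁ (f m) (g n))
    (fun m m₁ n => by rw [map_add, Ten.add_tmul])
    (fun m n n₁ => by rw [map_add, Ten.tmul_add])
    (fun i m n => by rw [hf, hg, Ten.balanced])

@[simp] theorem Ten.map_tmul {ρ : I → M →+ M} {σ : I → N →+ N} {ρ₁ : I → M₁ →+ M₁}
    {σ₁ : I → N₁ →+ N₁} (f : M →+ M₁) (g : N →+ N₁) (hf : ∀ i m, f (ρ i m) = ρ₁ i (f m))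
    (hg : ∀ i n, g (σ i n) = σ₁ i (g n)) (m : M) (n : N) :
    Ten.map f g hf hg (Ten.tmul ρ σ m n) = Ten.tmul ρ₁ σ₁ (f m) (g n) := rfl

/-- The map `f ⊗ id`. -/
def Ten.mapL {ρ : I → M →+ M} {σ : I → N →+ N} {ρ₁ : I → M₁ →+ M₁} (f : M →+ M₁)
    (hf : ∀ i m, f (ρ i m) = ρ₁ i (f m)) : Ten ρ σ →+ Ten ρ₁ σ :=
  Ten.map f (AddMonoidHom.id N) hf (fun _ _ => rfl)

/-- The map `id ⊗ g`. -/
def Ten.mapR {ρ : I → M →+ M} {σ : I → N →+ N} {σ₁ : I → N₁ →+ N₁} (g : N →+ N₁)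
    (hg : ∀ i n, g (σ i n) = σ₁ i (g n)) : Ten ρ σ →+ Ten ρ σ₁ :=
  Ten.map (AddMonoidHom.id M) g (fun _ _ => rfl) hg

@[simp] theorem Ten.mapL_tmul {ρ : I → M →+ M} {σ : I → N →+ N} {ρ₁ : I → M₁ →+ M₁}
    (f : M →+ M₁) (hf : ∀ i m, f (ρ i m) = ρ₁ i (f m)) (m : M) (n : N) :
    Ten.mapL f hf (Ten.tmul ρ σ m n) = Ten.tmul ρ₁ σ (f m) n := rfl

@[simp] theorem Ten.mapR_tmul {ρ : I → M →+ M} {σ : I → N →+ N} {σ₁ : I → N₁ →+ N₁}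
    (g : N →+ N₁) (hg : ∀ i n, g (σ i n) = σ₁ i (g n)) (m : M) (n : N) :
    Ten.mapR g hg (Ten.tmul ρ σ m n) = Ten.tmul ρ σ₁ m (g n) := rfl

/-- The action of `J` on `M ⊗_I N` through an action on `M` commuting with that of `I`. -/
def Ten.actL (ρ : I → M →+ M) (σ : I → N →+ N) (τ : J → M →+ M)
    (h : ∀ j i m, τ j (ρ i m) = ρ i (τ j m)) : J → Ten ρ σ →+ Ten ρ σ :=
  fun j => Ten.mapL (τ j) (h j)

@[simp] theorem Ten.actL_tmul (ρ : I → M →+ M) (σ : I → N →+ N) (τ : J → M →+ M)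
    (h : ∀ j i m, τ j (ρ i m) = ρ i (τ j m)) (j : J) (m : M) (n : N) :
    Ten.actL ρ σ τ h j (Ten.tmul ρ σ m n) = Ten.tmul ρ σ (τ j m) n := rfl

/-- The action of `J` on `M ⊗_I N` through an action on `N` commuting with that of `I`. -/
def Ten.actR (ρ : I → M →+ M) (σ : I → N →+ N) (τ : J → N →+ N)
    (h : ∀ j i n, τ j (σ i n) = σ i (τ j n)) : J → Ten ρ σ →+ Ten ρ σ :=
  fun j => Ten.mapR (τ j) (h j)

@[simp] theorem Ten.actR_tmul (ρ : I → M →+ M) (σ : I → N →+ N) (τ : J → N →+ N)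
    (h : ∀ j i n, τ j (σ i n) = σ i (τ j n)) (j : J) (m : M) (n : N) :
    Ten.actR ρ σ τ h j (Ten.tmul ρ σ m n) = Ten.tmul ρ σ m (τ j n) := rfl

/-- The map `m ⊗ n ↦ m ⊗ (n ⊗ p)`, for `p` in `P`. -/
def Ten.append {ρ : I → M →+ M} {σ : I → N →+ N} {τ : J → N →+ N} {κ : J → P →+ P}
    (h : ∀ j i n, τ j (σ i n) = σ i (τ j n)) (p : P) :
    Ten ρ σ →+ Ten ρ (Ten.actL τ κ σ (fun i j n => (h j i n).symm)) :=
  Ten.mapR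
    (AddMonoidHom.mk' (fun n => Ten.tmul τ κ n p) (fun n n₁ => Ten.add_tmul τ κ n n₁ p))
    (fun _ _ => rfl)

theorem Ten.append_tmul {ρ : I → M →+ M} {σ : I → N →+ N} {τ : J → N →+ N} {κ : J → P →+ P}
    (h : ∀ j i n, τ j (σ i n) = σ i (τ j n)) (p : P) (m : M) (n : N) :
    Ten.append (κ := κ) h p (Ten.tmul ρ σ m n) = Ten.tmul ρ _ m (Ten.tmul τ κ n p) := rfl

theorem Ten.append_add {ρ : I → M →+ M} {σ : I → N →+ N} {τ : J → N →+ N} {κ : J → P →+ P}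
    (h : ∀ j i n, τ j (σ i n) = σ i (τ j n)) (p p₁ : P) (z : Ten ρ σ) :
    Ten.append (κ := κ) h (p + p₁) z = Ten.append h p z + Ten.append h p₁ z := by
  rw [← AddMonoidHom.add_apply]
  refine Ten.hom_ext (fun m n => ?_) z
  rw [AddMonoidHom.add_apply, Ten.append_tmul, Ten.append_tmul, Ten.append_tmul, Ten.tmul_add,
    Ten.tmul_add]

theorem Ten.append_act {ρ : I → M →+ M} {σ : I → N →+ N} {τ : J → N →+ N} {κ : J → P →+ P}
    (h : ∀ j i n, τ j (σ i n) = σ i (τ j n)) (j : J) (p : P) (z : Ten ρ σ) :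
    Ten.append (κ := κ) h p (Ten.actR ρ σ τ h j z) = Ten.append h (κ j p) z := by
  rw [← AddMonoidHom.comp_apply]
  refine Ten.hom_ext (fun m n => ?_) z
  rw [AddMonoidHom.comp_apply, Ten.actR_tmul, Ten.append_tmul, Ten.append_tmul, Ten.balanced]

/-- The canonical map `(M ⊗_I N) ⊗_J P → M ⊗_I (N ⊗_J P)`, `(m ⊗ n) ⊗ p ↦ m ⊗ (n ⊗ p)`, for
commuting actions `σ` of `I` and `τ` of `J` on `N`. -/
def Ten.assoc {ρ : I → M →+ M} {σ : I → N →+ N} {τ : J → N →+ N} {κ : J → P →+ P}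
    (h : ∀ j i n, τ j (σ i n) = σ i (τ j n)) :
    Ten (Ten.actR ρ σ τ h) κ →+ Ten ρ (Ten.actL τ κ σ (fun i j n => (h j i n).symm)) :=
  Ten.lift (fun z p => Ten.append h p z)
    (fun z z₁ p => (Ten.append h p).map_add z z₁)
    (fun z p p₁ => Ten.append_add h p p₁ z)
    (fun j z p => Ten.append_act h j p z)

theorem Ten.assoc_tmul {ρ : I → M →+ M} {σ : I → N →+ N} {τ : J → N →+ N} {κ : J → P →+ P}
    (h : ∀ j i n, τ j (σ i n) = σ i (τ j n)) (m : M) (n : N) (p : P) :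
    Ten.assoc (κ := κ) h (Ten.tmul _ κ (Ten.tmul ρ σ m n) p) =
      Ten.tmul ρ _ m (Ten.tmul τ κ n p) := rfl

end Tensor

section Actions

variable {I A : Type*} [Ring A]

/-- The elements `f i` acting on `A` by left multiplication. -/
def lm (f : I → A) : I → A →+ A := fun i => AddMonoidHom.mulLeft (f i)

/-- The elements `f i` acting on `A` by right multiplication. -/
def rm (f : I → A) : I → A →+ A := fun i => AddMonoidHom.mulRight (f i)

@[simp] theorem lm_apply (f : I → A) (i : I) (a : A) : lm f i a = f i * a := rfl

@[simp] theorem rm_apply (f : I → A) (i : I) (a : A) : rm f i a = a * f i := rfl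

theorem rm_lm {J : Type*} (f : I → A) (g : J → A) (i : I) (j : J) (a : A) :
    rm f i (lm g j a) = lm g j (rm f i a) := mul_assoc _ _ _

theorem lm_rm {J : Type*} (f : I → A) (g : J → A) (i : I) (j : J) (a : A) :
    lm f i (rm g j a) = rm g j (lm f i a) := (mul_assoc _ _ _).symm

end Actions

section Base

/-- Source and target maps `s : K → A`, `t : Kᵒᵖ → A` with commuting images. -/
structure BaseMaps (A K : Type*) [Ring A] [Ring K] where
  s : K →+* A
  t : Kᵐᵒᵖ →+* A
  comm : ∀ k k₁, s k * t k₁ = t k₁ * s k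

variable {A K : Type*} [Ring A] [Ring K]

/-- The target map as a function on `K`. -/
def BaseMaps.tt (H : BaseMaps A K) : K → A := fun k => H.t (MulOpposite.op k)

theorem BaseMaps.lm_s_t (H : BaseMaps A K) (k k₁ : K) (a : A) :
    lm H.s k (lm H.tt k₁ a) = lm H.tt k₁ (lm H.s k a) := by
  simp only [lm_apply, ← mul_assoc]
  rw [BaseMaps.tt, H.comm]

theorem BaseMaps.rm_s_t (H : BaseMaps A K) (k k₁ : K) (a : A) :
    rm H.s k (rm H.tt k₁ a) = rm H.tt k₁ (rm H.s k a) := by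
  simp only [rm_apply, mul_assoc]
  rw [BaseMaps.tt, H.comm]

/-- The group `A_L ⊗ _LA`: here `t(l) a ⊗ b = a ⊗ s(l) b`. -/
abbrev BaseMaps.LTen (H : BaseMaps A K) : Type _ := Ten (lm H.tt) (lm H.s)

/-- The group `A^R ⊗ ^RA`: here `a s(r) ⊗ b = a ⊗ b t(r)`. -/
abbrev BaseMaps.RTen (H : BaseMaps A K) : Type _ := Ten (rm H.s) (rm H.tt)

/-- Right multiplication by `u ⊗ v` on `A_L ⊗ _LA`. -/
def BaseMaps.mulR (H : BaseMaps A K) (u v : A) : H.LTen →+ H.LTen :=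
  Ten.map (AddMonoidHom.mulRight u) (AddMonoidHom.mulRight v)
    (fun _ _ => mul_assoc _ _ _) (fun _ _ => mul_assoc _ _ _)

/-- Left multiplication by `u ⊗ v` on `A^R ⊗ ^RA`. -/
def BaseMaps.mulL (H : BaseMaps A K) (u v : A) : H.RTen →+ H.RTen :=
  Ten.map (AddMonoidHom.mulLeft u) (AddMonoidHom.mulLeft v)
    (fun _ _ => (mul_assoc _ _ _).symm) (fun _ _ => (mul_assoc _ _ _).symm)

theorem BaseMaps.mulR_tmul (H : BaseMaps A K) (u v a b : A) :
    H.mulR u v (Ten.tmul _ _ a b) = Ten.tmul _ _ (a * u) (b * v) := rfl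

theorem BaseMaps.mulL_tmul (H : BaseMaps A K) (u v a b : A) :
    H.mulL u v (Ten.tmul _ _ a b) = Ten.tmul _ _ (u * a) (v * b) := rfl

theorem BaseMaps.mulR_mulR (H : BaseMaps A K) (u v u₁ v₁ : A) (z : H.LTen) :
    H.mulR u v (H.mulR u₁ v₁ z) = H.mulR (u₁ * u) (v₁ * v) z := by
  rw [← AddMonoidHom.comp_apply]
  refine Ten.hom_ext (fun m n => ?_) z
  simp only [AddMonoidHom.comp_apply, BaseMaps.mulR_tmul, mul_assoc]

theorem BaseMaps.mulL_mulL (H : BaseMaps A K) (u v u₁ v₁ : A) (z : H.RTen) :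
    H.mulL u v (H.mulL u₁ v₁ z) = H.mulL (u * u₁) (v * v₁) z := by
  rw [← AddMonoidHom.comp_apply]
  refine Ten.hom_ext (fun m n => ?_) z
  simp only [AddMonoidHom.comp_apply, BaseMaps.mulL_tmul, mul_assoc]

theorem BaseMaps.mulR_one (H : BaseMaps A K) (z : H.LTen) : H.mulR 1 1 z = z := by
  refine Ten.hom_ext (g := AddMonoidHom.id _) (fun m n => ?_) z
  simp only [AddMonoidHom.id_apply, BaseMaps.mulR_tmul, mul_one]

theorem BaseMaps.mulL_one (H : BaseMaps A K) (z : H.RTen) : H.mulL 1 1 z = z := by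
  refine Ten.hom_ext (g := AddMonoidHom.id _) (fun m n => ?_) z
  simp only [AddMonoidHom.id_apply, BaseMaps.mulL_tmul, one_mul]

theorem BaseMaps.mulR_add_left (H : BaseMaps A K) (u u₁ v : A) (z : H.LTen) :
    H.mulR (u + u₁) v z = H.mulR u v z + H.mulR u₁ v z := by
  rw [← AddMonoidHom.add_apply]
  refine Ten.hom_ext (fun m n => ?_) z
  simp only [AddMonoidHom.add_apply, BaseMaps.mulR_tmul, mul_add, Ten.add_tmul]

theorem BaseMaps.mulR_add_right (H : BaseMaps A K) (u v v₁ : A) (z : H.LTen) :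
    H.mulR u (v + v₁) z = H.mulR u v z + H.mulR u v₁ z := by
  rw [← AddMonoidHom.add_apply]
  refine Ten.hom_ext (fun m n => ?_) z
  simp only [AddMonoidHom.add_apply, BaseMaps.mulR_tmul, mul_add, Ten.tmul_add]

theorem BaseMaps.mulL_add_left (H : BaseMaps A K) (u u₁ v : A) (z : H.RTen) :
    H.mulL (u + u₁) v z = H.mulL u v z + H.mulL u₁ v z := by
  rw [← AddMonoidHom.add_apply]
  refine Ten.hom_ext (fun m n => ?_) z
  simp only [AddMonoidHom.add_apply, BaseMaps.mulL_tmul, add_mul, Ten.add_tmul]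

theorem BaseMaps.mulL_add_right (H : BaseMaps A K) (u v v₁ : A) (z : H.RTen) :
    H.mulL u (v + v₁) z = H.mulL u v z + H.mulL u v₁ z := by
  rw [← AddMonoidHom.add_apply]
  refine Ten.hom_ext (fun m n => ?_) z
  simp only [AddMonoidHom.add_apply, BaseMaps.mulL_tmul, add_mul, Ten.tmul_add]

/-- `a₁ t(l) ⊗ a₂ = a₁ ⊗ a₂ s(l)` for the element `z = a₁ ⊗ a₂` of `A_L ⊗ _LA`. -/
def BaseMaps.IsTakeuchiL (H : BaseMaps A K) (z : H.LTen) : Prop :=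
  ∀ k, H.mulR (H.tt k) 1 z = H.mulR 1 (H.s k) z

/-- `s(r) a₁ ⊗ a₂ = a₁ ⊗ t(r) a₂` for the element `z = a₁ ⊗ a₂` of `A^R ⊗ ^RA`. -/
def BaseMaps.IsTakeuchiR (H : BaseMaps A K) (z : H.RTen) : Prop :=
  ∀ k, H.mulL (H.s k) 1 z = H.mulL 1 (H.tt k) z

/-- The factorwise product `w ↦ z w` on `A_L ⊗ _LA`, for `z` as above. -/
def BaseMaps.prodL (H : BaseMaps A K) (z : H.LTen) (hz : H.IsTakeuchiL z) : H.LTen →+ H.LTen :=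
  Ten.lift (fun u v => H.mulR u v z)
    (fun u u₁ v => H.mulR_add_left u u₁ v z) (fun u v v₁ => H.mulR_add_right u v v₁ z)
    (fun k u v => by
      have h := congrArg (H.mulR u v) (hz k)
      simpa only [BaseMaps.mulR_mulR, one_mul, lm_apply] using h)

/-- The factorwise product `w ↦ w z` on `A^R ⊗ ^RA`, for `z` as above. -/
def BaseMaps.prodR (H : BaseMaps A K) (z : H.RTen) (hz : H.IsTakeuchiR z) : H.RTen →+ H.RTen :=
  Ten.lift (fun u v => H.mulL u v z)
    (fun u u₁ v => H.mulL_add_left u u₁ v z) (fun u v v₁ => H.mulL_add_right u v v₁ z)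
    (fun k u v => by
      have h := congrArg (H.mulL u v) (hz k)
      simpa only [BaseMaps.mulL_mulL, mul_one, rm_apply] using h)

end Base

section Left

/-- A left bialgebroid `(A, L, s, t, γ, π)` on the ring `A` over the ring `L`. -/
structure LeftBialgebroid (A L : Type*) [Ring A] [Ring L] extends BaseMaps A L where
  γ : A →+ toBaseMaps.LTen
  π : A →+ L
  γ_s : ∀ l a, γ (s l * a) =
    Ten.actL (lm toBaseMaps.tt) (lm s) (lm s) toBaseMaps.lm_s_t l (γ a)
  γ_t : ∀ l a, γ (toBaseMaps.tt l * a) =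
    Ten.actR (lm toBaseMaps.tt) (lm s) (lm toBaseMaps.tt)
      (fun j i n => (toBaseMaps.lm_s_t i j n).symm) l (γ a)
  π_s : ∀ l a, π (s l * a) = l * π a
  π_t : ∀ l a, π (toBaseMaps.tt l * a) = π a * l
  coassoc : ∀ a,
    Ten.assoc (fun j i n => (toBaseMaps.lm_s_t i j n).symm)
      (Ten.mapL γ γ_t (γ a)) =
    Ten.mapR γ γ_s (γ a)
  counit_left : ∀ a,
    Ten.lift (ρ := lm toBaseMaps.tt) (σ := lm s) (fun x y => s (π x) * y)
      (fun x x₁ y => by rw [map_add, map_add, add_mul]) (fun x y y₁ => mul_add _ _ _)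
      (fun l x y => by rw [lm_apply, lm_apply, π_t, map_mul, mul_assoc]) (γ a) = a
  counit_right : ∀ a,
    Ten.lift (ρ := lm toBaseMaps.tt) (σ := lm s) (fun x y => toBaseMaps.tt (π y) * x)
      (fun x x₁ y => mul_add _ _ _)
      (fun x y y₁ => by rw [map_add]; unfold BaseMaps.tt; rw [MulOpposite.op_add, map_add, add_mul])
      (fun l x y => by
        rw [lm_apply, lm_apply, π_s]; unfold BaseMaps.tt
        rw [MulOpposite.op_mul, map_mul, mul_assoc]) (γ a) = a
  takeuchi : ∀ a, toBaseMaps.IsTakeuchiL (γ a)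
  γ_one : γ 1 = Ten.tmul _ _ 1 1
  γ_mul : ∀ a b, γ (a * b) = toBaseMaps.prodL (γ a) (takeuchi a) (γ b)
  π_one : π 1 = 1
  π_mul_s : ∀ a b, π (a * s (π b)) = π (a * b)
  π_mul_t : ∀ a b, π (a * toBaseMaps.tt (π b)) = π (a * b)

/-- A right bialgebroid `(A, R, s, t, γ, π)` on the ring `A` over the ring `R`. -/
structure RightBialgebroid (A R : Type*) [Ring A] [Ring R] extends BaseMaps A R where
  γ : A →+ toBaseMaps.RTen
  π : A →+ R
  γ_s : ∀ r a, γ (a * s r) =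
    Ten.actR (rm s) (rm toBaseMaps.tt) (rm s) toBaseMaps.rm_s_t r (γ a)
  γ_t : ∀ r a, γ (a * toBaseMaps.tt r) =
    Ten.actL (rm s) (rm toBaseMaps.tt) (rm toBaseMaps.tt)
      (fun j i n => (toBaseMaps.rm_s_t i j n).symm) r (γ a)
  π_s : ∀ r a, π (a * s r) = π a * r
  π_t : ∀ r a, π (a * toBaseMaps.tt r) = r * π a
  coassoc : ∀ a,
    Ten.assoc toBaseMaps.rm_s_t
      (Ten.mapL γ γ_s (γ a)) =
    Ten.mapR γ γ_t (γ a)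
  counit_left : ∀ a,
    Ten.lift (ρ := rm s) (σ := rm toBaseMaps.tt) (fun x y => y * toBaseMaps.tt (π x))
      (fun x x₁ y => by rw [map_add]; unfold BaseMaps.tt; rw [MulOpposite.op_add, map_add, mul_add])
      (fun x y y₁ => add_mul _ _ _)
      (fun r x y => by
        rw [rm_apply, rm_apply, π_s]; unfold BaseMaps.tt
        rw [MulOpposite.op_mul, map_mul, mul_assoc]) (γ a) = a
  counit_right : ∀ a,
    Ten.lift (ρ := rm s) (σ := rm toBaseMaps.tt) (fun x y => x * s (π y))
      (fun x x₁ y => add_mul _ _ _) (fun x y y₁ => by rw [map_add, map_add, mul_add])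
      (fun r x y => by rw [rm_apply, rm_apply, π_t, map_mul, mul_assoc]) (γ a) = a
  takeuchi : ∀ a, toBaseMaps.IsTakeuchiR (γ a)
  γ_one : γ 1 = Ten.tmul _ _ 1 1
  γ_mul : ∀ a b, γ (a * b) = toBaseMaps.prodR (γ b) (takeuchi b) (γ a)
  π_one : π 1 = 1
  π_mul_s : ∀ a b, π (s (π a) * b) = π (a * b)
  π_mul_t : ∀ a b, π (toBaseMaps.tt (π a) * b) = π (a * b)

end Left

section Lemmas

variable {A L R : Type*} [Ring A] [Ring L] [Ring R]

theorem LeftBialgebroid.γ_src (H : LeftBialgebroid A L) (l : L) :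
    H.γ (H.s l) = Ten.tmul _ _ (H.s l) 1 := by
  have h := H.γ_s l 1
  rw [mul_one, H.γ_one] at h
  rw [h]
  simp [Ten.actL]

theorem LeftBialgebroid.γ_tgt (H : LeftBialgebroid A L) (l : L) :
    H.γ (H.tt l) = Ten.tmul _ _ 1 (H.tt l) := by
  have h := H.γ_t l 1
  rw [mul_one, H.γ_one] at h
  rw [h]
  simp [Ten.actR]

theorem LeftBialgebroid.γ_mul_s (H : LeftBialgebroid A L) (a : A) (l : L) :
    H.γ (a * H.s l) = H.mulR (H.s l) 1 (H.γ a) := by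
  rw [H.γ_mul, H.γ_src]; rfl

theorem LeftBialgebroid.γ_mul_t (H : LeftBialgebroid A L) (a : A) (l : L) :
    H.γ (a * H.tt l) = H.mulR 1 (H.tt l) (H.γ a) := by
  rw [H.γ_mul, H.γ_tgt]; rfl

theorem RightBialgebroid.γ_src (H : RightBialgebroid A R) (r : R) :
    H.γ (H.s r) = Ten.tmul _ _ 1 (H.s r) := by
  have h := H.γ_s r 1
  rw [one_mul, H.γ_one] at h
  rw [h]
  simp [Ten.actR]

theorem RightBialgebroid.γ_tgt (H : RightBialgebroid A R) (r : R) :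
    H.γ (H.tt r) = Ten.tmul _ _ (H.tt r) 1 := by
  have h := H.γ_t r 1
  rw [one_mul, H.γ_one] at h
  rw [h]
  simp [Ten.actL]

theorem RightBialgebroid.γ_s_mul (H : RightBialgebroid A R) (a : A) (r : R) :
    H.γ (H.s r * a) = H.mulL 1 (H.s r) (H.γ a) := by
  rw [H.γ_mul, H.γ_src]; rfl

theorem RightBialgebroid.γ_t_mul (H : RightBialgebroid A R) (a : A) (r : R) :
    H.γ (H.tt r * a) = H.mulL (H.tt r) 1 (H.γ a) := by
  rw [H.γ_mul, H.γ_tgt]; rfl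

theorem actR_rm_eq (H : BaseMaps A L) {I : Type*} (f : I → A) (i : I) (z : H.LTen) :
    Ten.actR (lm H.tt) (lm H.s) (rm f) (rm_lm _ _) i z = H.mulR 1 (f i) z := by
  refine Ten.hom_ext (fun m n => ?_) z
  simp only [Ten.actR_tmul, BaseMaps.mulR_tmul, rm_apply, mul_one]

theorem actL_rm_eq (H : BaseMaps A L) {I : Type*} (f : I → A) (i : I) (z : H.LTen) :
    Ten.actL (lm H.tt) (lm H.s) (rm f) (rm_lm _ _) i z = H.mulR (f i) 1 z := by
  refine Ten.hom_ext (fun m n => ?_) z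
  simp only [Ten.actL_tmul, BaseMaps.mulR_tmul, rm_apply, mul_one]

theorem actR_lm_eq (H : BaseMaps A R) {I : Type*} (f : I → A) (i : I) (z : H.RTen) :
    Ten.actR (rm H.s) (rm H.tt) (lm f) (lm_rm _ _) i z = H.mulL 1 (f i) z := by
  refine Ten.hom_ext (fun m n => ?_) z
  simp only [Ten.actR_tmul, BaseMaps.mulL_tmul, lm_apply, one_mul]

theorem actL_lm_eq (H : BaseMaps A R) {I : Type*} (f : I → A) (i : I) (z : H.RTen) :
    Ten.actL (rm H.s) (rm H.tt) (lm f) (lm_rm _ _) i z = H.mulL (f i) 1 z := by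
  refine Ten.hom_ext (fun m n => ?_) z
  simp only [Ten.actL_tmul, BaseMaps.mulL_tmul, lm_apply, one_mul]

end Lemmas

section Mixed

variable {A L I : Type*} [Ring A] [Ring L]

/-- `(γ_L ⊗ id) ∘ γ_R = (id ⊗ γ_R) ∘ γ_L` as maps `A → A_L ⊗ _LA^R ⊗ ^RA`, where `A^R` and `^RA`
are given by right multiplication with the elements `f r` and `g r`. The two hypotheses say that
`γ_L ⊗ id` and `id ⊗ γ_R` are well defined. -/
def MixedLR (H : LeftBialgebroid A L) (f g : I → A) (γR : A →+ Ten (rm f) (rm g))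
    (hf : ∀ r a, H.γ (a * f r) =
      Ten.actR (lm H.tt) (lm H.s) (rm f) (rm_lm _ _) r (H.γ a))
    (hs : ∀ l a, γR (H.s l * a) =
      Ten.actL (rm f) (rm g) (lm H.s) (lm_rm _ _) l (γR a)) : Prop :=
  ∀ a, Ten.assoc (rm_lm f H.s)
      (Ten.mapL H.γ hf (γR a)) =
    Ten.mapR γR hs (H.γ a)

/-- `(γ_R ⊗ id) ∘ γ_L = (id ⊗ γ_L) ∘ γ_R` as maps `A → A^R ⊗ ^RA_L ⊗ _LA`. -/
def MixedRL (H : LeftBialgebroid A L) (f g : I → A) (γR : A →+ Ten (rm f) (rm g))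
    (hg : ∀ r a, H.γ (a * g r) =
      Ten.actL (lm H.tt) (lm H.s) (rm g) (rm_lm _ _) r (H.γ a))
    (ht : ∀ l a, γR (H.tt l * a) =
      Ten.actR (rm f) (rm g) (lm H.tt) (lm_rm _ _) l (γR a)) : Prop :=
  ∀ a, Ten.assoc (lm_rm H.tt g)
      (Ten.mapL γR ht (H.γ a)) =
    Ten.mapR H.γ hg (γR a)

end Mixed

section HopfI

variable {A L : Type*} [Ring A] [Ring L]

theorem S_t_mul (H : LeftBialgebroid A L) (S : A ≃+ A) (anti : ∀ a b, S (a * b) = S b * S a)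
    (S_t : ∀ l, S (H.tt l) = H.s l) (l : L) (a : A) : S (H.tt l * a) = S a * H.s l := by
  rw [anti, S_t]

theorem anti_symm (S : A ≃+ A) (anti : ∀ a b, S (a * b) = S b * S a) (a b : A) :
    S.symm (a * b) = S.symm b * S.symm a := by
  apply S.injective
  rw [anti]; simp

theorem Sinv_s_mul (H : LeftBialgebroid A L) (S : A ≃+ A) (anti : ∀ a b, S (a * b) = S b * S a)
    (S_t : ∀ l, S (H.tt l) = H.s l) (l : L) (a : A) :
    S.symm (H.s l * a) = S.symm a * H.tt l := by
  rw [anti_symm S anti, ← S_t, S.symm_apply_apply]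

/-- The map `a ⊗ b ↦ S(a) b` on `A_L ⊗ _LA`. -/
def antipodeMulL (H : LeftBialgebroid A L) (S : A ≃+ A)
    (h : ∀ l a, S (H.tt l * a) = S a * H.s l) : H.LTen →+ A :=
  Ten.lift (fun x y => S x * y) (fun x x₁ y => by rw [map_add, add_mul])
    (fun x y y₁ => mul_add _ _ _)
    (fun l x y => by rw [lm_apply, lm_apply, h, mul_assoc])

/-- The map `a ⊗ b ↦ S(a)₁ b ⊗ S(a)₂` on `A_L ⊗ _LA`. -/
def axiomMapS (H : LeftBialgebroid A L) (S : A ≃+ A)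
    (h : ∀ l a, S (H.tt l * a) = S a * H.s l) : H.LTen →+ H.LTen :=
  Ten.lift (fun x y => H.mulR y 1 (H.γ (S x)))
    (fun x x₁ y => by rw [map_add, map_add, map_add])
    (fun x y y₁ => H.mulR_add_left y y₁ 1 _)
    (fun l x y => by
      rw [lm_apply, lm_apply, h, H.γ_mul_s, BaseMaps.mulR_mulR, one_mul])

/-- The map `a ⊗ b ↦ S⁻¹(b)₁ ⊗ S⁻¹(b)₂ a` on `A_L ⊗ _LA`. -/
def axiomMapSinv (H : LeftBialgebroid A L) (S : A ≃+ A)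
    (h : ∀ l a, S.symm (H.s l * a) = S.symm a * H.tt l) : H.LTen →+ H.LTen :=
  Ten.lift (fun x y => H.mulR 1 x (H.γ (S.symm y)))
    (fun x x₁ y => H.mulR_add_right 1 x x₁ _)
    (fun x y y₁ => by rw [map_add, map_add, map_add])
    (fun l x y => by
      rw [lm_apply, lm_apply, h, H.γ_mul_t, BaseMaps.mulR_mulR, one_mul])

/-- `(A_L, S)` is a Hopf algebroid: `S` is an anti-automorphism of the ring `A`, `S ∘ t = s`,
`S⁻¹(a₂)₁ ⊗ S⁻¹(a₂)₂ a₁ = S⁻¹(a) ⊗ 1` and `S(a₁)₁ a₂ ⊗ S(a₁)₂ = 1 ⊗ S(a)`. -/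
structure IsHopfAlgebroid (H : LeftBialgebroid A L) (S : A ≃+ A) : Prop where
  anti : ∀ a b, S (a * b) = S b * S a
  S_t : ∀ l, S (H.tt l) = H.s l
  ax_Sinv : ∀ a, axiomMapSinv H S (Sinv_s_mul H S anti S_t) (H.γ a) = Ten.tmul _ _ (S.symm a) 1
  ax_S : ∀ a, axiomMapS H S (S_t_mul H S anti S_t) (H.γ a) = Ten.tmul _ _ 1 (S a)

end HopfI

section HopfII

variable {A L R : Type*} [Ring A] [Ring L] [Ring R]

/-- `θ = π ∘ S ∘ s : L → L`. -/
def theta (H : LeftBialgebroid A L) (S : A ≃+ A) (l : L) : L := H.π (S (H.s l))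

/-- `S` is an anti-automorphism of the ring `A` with `S ∘ t = s`, `S(a₁) a₂ = t(π(S(a)))`, and
`θ` is bijective (so that `θ⁻¹` below makes sense). -/
structure LuBase (H : LeftBialgebroid A L) (S : A ≃+ A) : Prop where
  anti : ∀ a b, S (a * b) = S b * S a
  S_t : ∀ l, S (H.tt l) = H.s l
  S_mul : ∀ a, antipodeMulL H S (S_t_mul H S anti S_t) (H.γ a) = H.tt (H.π (S a))
  theta_bij : Function.Bijective (theta H S)

variable {H : LeftBialgebroid A L} {S : A ≃+ A}

/-- The inverse of `θ`. -/
noncomputable def LuBase.thetaInv (h : LuBase H S) : L → L :=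
  (Equiv.ofBijective _ h.theta_bij).symm

theorem LuBase.thetaInv_theta (h : LuBase H S) (l : L) : h.thetaInv (theta H S l) = l :=
  (Equiv.ofBijective _ h.theta_bij).symm_apply_apply l

theorem LuBase.theta_thetaInv (h : LuBase H S) (l : L) : theta H S (h.thetaInv l) = l :=
  (Equiv.ofBijective _ h.theta_bij).apply_symm_apply l

theorem LuBase.S_s (h : LuBase H S) (l : L) : S (H.s l) = H.tt (theta H S l) := by
  have e := h.S_mul (H.s l)
  rw [H.γ_src] at e
  simpa [antipodeMulL, theta] using e

/-- The elements by which `R` acts on `A^R`: `a · r = a t(μ⁻¹(r))`. -/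
def srcElt (H : LeftBialgebroid A L) (μ : Lᵐᵒᵖ ≃+* R) (r : R) : A :=
  H.tt (MulOpposite.unop (μ.symm r))

/-- The elements by which `R` acts on `^RA`: `r · a = a s(θ⁻¹(μ⁻¹(r)))`. -/
noncomputable def LuBase.tgtElt (h : LuBase H S) (μ : Lᵐᵒᵖ ≃+* R) (r : R) : A :=
  H.s (h.thetaInv (MulOpposite.unop (μ.symm r)))

theorem LuBase.S_tgtElt (h : LuBase H S) (μ : Lᵐᵒᵖ ≃+* R) (r : R) :
    S (h.tgtElt μ r) = srcElt H μ r := by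
  rw [LuBase.tgtElt, h.S_s, h.theta_thetaInv]; rfl

theorem LuBase.tgtElt_op (h : LuBase H S) (μ : Lᵐᵒᵖ ≃+* R) (l : L) :
    h.tgtElt μ (μ (MulOpposite.op (theta H S l))) = H.s l := by
  simp [LuBase.tgtElt, h.thetaInv_theta]

theorem srcElt_op (H : LeftBialgebroid A L) (μ : Lᵐᵒᵖ ≃+* R) (l : L) :
    srcElt H μ (μ (MulOpposite.op l)) = H.tt l := by
  simp [srcElt]

/-- The group `A^R ⊗ ^RA` for these two actions. -/
abbrev LuBase.RTen (h : LuBase H S) (μ : Lᵐᵒᵖ ≃+* R) : Type _ :=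
  Ten (rm (srcElt H μ)) (rm (h.tgtElt μ))

/-- `A_L ⊗ _LA → A^R ⊗ ^RA`, `a ⊗ b ↦ S(b) ⊗ S(a)`. -/
noncomputable def LuBase.twistL (h : LuBase H S) (μ : Lᵐᵒᵖ ≃+* R) : H.LTen →+ h.RTen μ :=
  Ten.lift (fun x y => Ten.tmul _ _ (S y) (S x))
    (fun x x₁ y => by rw [map_add, Ten.tmul_add])
    (fun x y y₁ => by rw [map_add, Ten.add_tmul])
    (fun l x y => by
      have e := Ten.balanced (rm (srcElt H μ)) (rm (h.tgtElt μ))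
        (μ (MulOpposite.op (theta H S l))) (S y) (S x)
      rw [rm_apply, rm_apply, h.tgtElt_op, srcElt_op] at e
      rw [lm_apply, lm_apply, h.anti, h.anti, h.S_t, h.S_s, e])

/-- `A^R ⊗ ^RA → A_L ⊗ _LA`, `a ⊗ b ↦ S(b) ⊗ S(a)`, with its inverse
`a ⊗ b ↦ S⁻¹(b) ⊗ S⁻¹(a)`. -/
noncomputable def LuBase.twistR (h : LuBase H S) (μ : Lᵐᵒᵖ ≃+* R) : h.RTen μ ≃+ H.LTen :=
  AddMonoidHom.toAddEquiv
    (Ten.lift (fun x y => Ten.tmul _ _ (S y) (S x))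
      (fun x x₁ y => by rw [map_add, Ten.tmul_add])
      (fun x y y₁ => by rw [map_add, Ten.add_tmul])
      (fun r x y => by
        have e := Ten.balanced (lm H.tt) (lm H.s) (MulOpposite.unop (μ.symm r)) (S y) (S x)
        rw [lm_apply, lm_apply] at e
        rw [rm_apply, rm_apply, h.anti, h.anti, h.S_tgtElt, srcElt, h.S_t, e]))
    (Ten.lift (fun x y => Ten.tmul _ _ (S.symm y) (S.symm x))
      (fun x x₁ y => by rw [map_add, Ten.tmul_add])
      (fun x y y₁ => by rw [map_add, Ten.add_tmul])
      (fun l x y => by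
        have e := Ten.balanced (rm (srcElt H μ)) (rm (h.tgtElt μ))
          (μ (MulOpposite.op l)) (S.symm y) (S.symm x)
        have e1 : S.symm (H.tt l) = h.tgtElt μ (μ (MulOpposite.op l)) := by
          rw [← srcElt_op H μ l, ← h.S_tgtElt, S.symm_apply_apply]
        rw [rm_apply, rm_apply, srcElt_op] at e
        rw [lm_apply, lm_apply, anti_symm S h.anti, e1, Sinv_s_mul H S h.anti h.S_t, e]))
    (by
      ext z
      refine Ten.hom_ext (fun x y => ?_) z
      simp)
    (by
      ext z
      refine Ten.hom_ext (fun x y => ?_) z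
      simp)

/-- `γ_R = (a ⊗ b ↦ S(b) ⊗ S(a)) ∘ γ_L ∘ S⁻¹ : A → A^R ⊗ ^RA`. -/
noncomputable def LuBase.gammaR (h : LuBase H S) (μ : Lᵐᵒᵖ ≃+* R) : A →+ h.RTen μ :=
  ((h.twistL μ).comp H.γ).comp S.symm.toAddMonoidHom

theorem LuBase.twistL_tmul (h : LuBase H S) (μ : Lᵐᵒᵖ ≃+* R) (x y : A) :
    h.twistL μ (Ten.tmul _ _ x y) = Ten.tmul _ _ (S y) (S x) := rfl

theorem LuBase.twistL_mulR_t (h : LuBase H S) (μ : Lᵐᵒᵖ ≃+* R) (l : L) (z : H.LTen) :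
    h.twistL μ (H.mulR 1 (H.tt l) z) =
      Ten.actL (rm (srcElt H μ)) (rm (h.tgtElt μ)) (lm H.s) (lm_rm _ _) l (h.twistL μ z) := by
  rw [← AddMonoidHom.comp_apply, ← AddMonoidHom.comp_apply]
  refine Ten.hom_ext (fun x y => ?_) z
  rw [AddMonoidHom.comp_apply, AddMonoidHom.comp_apply, BaseMaps.mulR_tmul, h.twistL_tmul,
    h.twistL_tmul, Ten.actL_tmul, lm_apply, h.anti, h.S_t, mul_one]

theorem LuBase.twistL_mulR_s (h : LuBase H S) (μ : Lᵐᵒᵖ ≃+* R) (l : L) (z : H.LTen) :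
    h.twistL μ (H.mulR (H.s (h.thetaInv l)) 1 z) =
      Ten.actR (rm (srcElt H μ)) (rm (h.tgtElt μ)) (lm H.tt) (lm_rm _ _) l (h.twistL μ z) := by
  rw [← AddMonoidHom.comp_apply, ← AddMonoidHom.comp_apply]
  refine Ten.hom_ext (fun x y => ?_) z
  rw [AddMonoidHom.comp_apply, AddMonoidHom.comp_apply, BaseMaps.mulR_tmul, h.twistL_tmul,
    h.twistL_tmul, Ten.actR_tmul, lm_apply, mul_one, h.anti, h.S_s, h.theta_thetaInv]

theorem LuBase.gammaR_s (h : LuBase H S) (μ : Lᵐᵒᵖ ≃+* R) (l : L) (a : A) :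
    h.gammaR μ (H.s l * a) =
      Ten.actL (rm (srcElt H μ)) (rm (h.tgtElt μ)) (lm H.s) (lm_rm _ _) l (h.gammaR μ a) := by
  refine Eq.trans ?_ (h.twistL_mulR_t μ l (H.γ (S.symm a)))
  rw [← H.γ_mul_t, ← Sinv_s_mul H S h.anti h.S_t]
  rfl

theorem LuBase.gammaR_t (h : LuBase H S) (μ : Lᵐᵒᵖ ≃+* R) (l : L) (a : A) :
    h.gammaR μ (H.tt l * a) =
      Ten.actR (rm (srcElt H μ)) (rm (h.tgtElt μ)) (lm H.tt) (lm_rm _ _) l (h.gammaR μ a) := by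
  refine Eq.trans ?_ (h.twistL_mulR_s μ l (H.γ (S.symm a)))
  have e1 : S.symm (H.tt l) = H.s (h.thetaInv l) := by
    rw [AddEquiv.symm_apply_eq, h.S_s, h.theta_thetaInv]
  rw [← H.γ_mul_s, ← e1, ← anti_symm S h.anti]
  rfl

theorem LuBase.γ_mul_src (H : LeftBialgebroid A L) (μ : Lᵐᵒᵖ ≃+* R) (r : R) (a : A) :
    H.γ (a * srcElt H μ r) =
      Ten.actR (lm H.tt) (lm H.s) (rm (srcElt H μ)) (rm_lm _ _) r (H.γ a) := by
  rw [actR_rm_eq, srcElt, H.γ_mul_t]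

theorem LuBase.γ_mul_tgt (h : LuBase H S) (μ : Lᵐᵒᵖ ≃+* R) (r : R) (a : A) :
    H.γ (a * h.tgtElt μ r) =
      Ten.actL (lm H.tt) (lm H.s) (rm (h.tgtElt μ)) (rm_lm _ _) r (H.γ a) := by
  rw [actL_rm_eq, LuBase.tgtElt, H.γ_mul_s]

/-- The Lu-style axioms: the conditions above, the equality of the two candidates for `γ_R`,
and the two mixed coassociativity laws. -/
structure IsLuForm (H : LeftBialgebroid A L) (S : A ≃+ A) (μ : Lᵐᵒᵖ ≃+* R) : Prop
    extends LuBase H S where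
  gammaR_eq : ∀ a, toLuBase.twistL μ (H.γ (S.symm a)) = (toLuBase.twistR μ).symm (H.γ (S a))
  mixed_LR : MixedLR H (srcElt H μ) (toLuBase.tgtElt μ) (toLuBase.gammaR μ)
    (LuBase.γ_mul_src H μ) (toLuBase.gammaR_s μ)
  mixed_RL : MixedRL H (srcElt H μ) (toLuBase.tgtElt μ) (toLuBase.gammaR μ)
    (toLuBase.γ_mul_tgt μ) (toLuBase.gammaR_t μ)

end HopfII

section HopfIII

variable {A L R : Type*} [Ring A] [Ring L] [Ring R]

/-- `s_L(L) = t_R(R)` and `t_L(L) = s_R(R)` as subrings of `A`. -/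
structure SameBase (H : LeftBialgebroid A L) (G : RightBialgebroid A R) : Prop where
  s_eq : H.s.range = G.t.range
  t_eq : H.t.range = G.s.range

variable {H : LeftBialgebroid A L} {G : RightBialgebroid A R}

theorem SameBase.exists_tR (h : SameBase H G) (l : L) : ∃ r, G.tt r = H.s l := by
  have hm : H.s l ∈ G.t.range := h.s_eq ▸ ⟨l, rfl⟩
  obtain ⟨r, hr⟩ := hm
  exact ⟨r.unop, hr⟩

theorem SameBase.exists_sR (h : SameBase H G) (l : L) : ∃ r, G.s r = H.tt l := by
  have hm : H.tt l ∈ G.s.range := h.t_eq ▸ ⟨MulOpposite.op l, rfl⟩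
  exact hm

theorem SameBase.exists_sL (h : SameBase H G) (r : R) : ∃ l, H.s l = G.tt r := by
  have hm : G.tt r ∈ H.s.range := h.s_eq ▸ ⟨MulOpposite.op r, rfl⟩
  exact hm

theorem SameBase.exists_tL (h : SameBase H G) (r : R) : ∃ l, H.tt l = G.s r := by
  have hm : G.s r ∈ H.t.range := h.t_eq ▸ ⟨r, rfl⟩
  obtain ⟨l, hl⟩ := hm
  exact ⟨l.unop, hl⟩

theorem SameBase.γL_mul_sR (h : SameBase H G) (r : R) (a : A) :
    H.γ (a * G.s r) =
      Ten.actR (lm H.tt) (lm H.s) (rm G.s) (rm_lm _ _) r (H.γ a) := by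
  obtain ⟨l, hl⟩ := h.exists_tL r
  rw [actR_rm_eq, ← hl, H.γ_mul_t]

theorem SameBase.γL_mul_tR (h : SameBase H G) (r : R) (a : A) :
    H.γ (a * G.tt r) =
      Ten.actL (lm H.tt) (lm H.s) (rm G.tt) (rm_lm _ _) r (H.γ a) := by
  obtain ⟨l, hl⟩ := h.exists_sL r
  rw [actL_rm_eq, ← hl, H.γ_mul_s]

theorem SameBase.γR_sL_mul (h : SameBase H G) (l : L) (a : A) :
    G.γ (H.s l * a) =
      Ten.actL (rm G.s) (rm G.tt) (lm H.s) (lm_rm _ _) l (G.γ a) := by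
  obtain ⟨r, hr⟩ := h.exists_tR l
  rw [actL_lm_eq, ← hr, G.γ_t_mul]

theorem SameBase.γR_tL_mul (h : SameBase H G) (l : L) (a : A) :
    G.γ (H.tt l * a) =
      Ten.actR (rm G.s) (rm G.tt) (lm H.tt) (lm_rm _ _) l (G.γ a) := by
  obtain ⟨r, hr⟩ := h.exists_sR l
  rw [actR_lm_eq, ← hr, G.γ_s_mul]

/-- The compatibility of a left and a right bialgebroid on the same total ring: `R ≃ Lᵒᵖ`, the
images of the base rings agree, and the two mixed coassociativity laws hold. -/
structure IsCompatible (H : LeftBialgebroid A L) (G : RightBialgebroid A R) : Prop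
    extends SameBase H G where
  base_iso : Nonempty (R ≃+* Lᵐᵒᵖ)
  mixed_LR : MixedLR H G.s G.tt G.γ toSameBase.γL_mul_sR toSameBase.γR_sL_mul
  mixed_RL : MixedRL H G.s G.tt G.γ toSameBase.γL_mul_tR toSameBase.γR_tL_mul

/-- The map `a ⊗ b ↦ a S(b)` on `A^R ⊗ ^RA`. -/
def antipodeMulR (G : RightBialgebroid A R) (S : A ≃+ A)
    (h : ∀ r a, S (a * G.tt r) = G.s r * S a) : G.RTen →+ A :=
  Ten.lift (fun x y => x * S y) (fun x x₁ y => add_mul _ _ _)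
    (fun x y y₁ => by rw [map_add, mul_add])
    (fun r x y => by rw [rm_apply, rm_apply, h, mul_assoc])

theorem tL_of_bimodule {S : A ≃+ A}
    (h : ∀ l l₁ a, S (H.tt l * a * H.tt l₁) = H.s l₁ * S a * H.s l) (l : L) (a : A) :
    S (H.tt l * a) = S a * H.s l := by
  have e := h l 1 a
  have h1 : H.tt 1 = 1 := map_one H.t
  rwa [h1, mul_one, map_one, one_mul] at e

theorem tR_of_bimodule {S : A ≃+ A}
    (h : ∀ r r₁ a, S (G.tt r₁ * a * G.tt r) = G.s r * S a * G.s r₁) (r : R) (a : A) :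
    S (a * G.tt r) = G.s r * S a := by
  have e := h r 1 a
  have h1 : G.tt 1 = 1 := map_one G.t
  rwa [h1, one_mul, map_one, mul_one] at e

/-- The symmetric form: compatible left and right bialgebroids and an additive bijection `S`
that is a twisted bimodule map and satisfies `S(a₁) a₂ = s_R(π_R(a))` for `γ_L(a) = a₁ ⊗ a₂` and
`a¹ S(a²) = s_L(π_L(a))` for `γ_R(a) = a¹ ⊗ a²`. -/
structure IsSymmetricForm (H : LeftBialgebroid A L) (G : RightBialgebroid A R) (S : A ≃+ A) : Prop
    extends IsCompatible H G where
  S_tL : ∀ l l₁ a, S (H.tt l * a * H.tt l₁) = H.s l₁ * S a * H.s l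
  S_tR : ∀ r r₁ a, S (G.tt r₁ * a * G.tt r) = G.s r * S a * G.s r₁
  S_mul : ∀ a, antipodeMulL H S (tL_of_bimodule S_tL) (H.γ a) = G.s (G.π a)
  mul_S : ∀ a, antipodeMulR G S (tR_of_bimodule S_tR) (G.γ a) = H.s (H.π a)

/-- `α : A^R ⊗ _RA → A_L ⊗ _LA`, `a ⊗ b ↦ a₁ ⊗ a₂ b`; in the source `a s_R(r) ⊗ b = a ⊗ s_R(r) b`. -/
def SameBase.alpha (h : SameBase H G) : Ten (rm G.s) (lm G.s) →+ H.LTen :=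
  Ten.lift (fun x y => H.mulR 1 y (H.γ x)) (fun x x₁ y => by rw [map_add, map_add])
    (fun x y y₁ => H.mulR_add_right 1 y y₁ _)
    (fun r x y => by
      rw [rm_apply, lm_apply, h.γL_mul_sR, actR_rm_eq, BaseMaps.mulR_mulR, one_mul])

/-- `β : A_R ⊗ ^RA → A_L ⊗ _LA`, `a ⊗ b ↦ b₁ a ⊗ b₂`; in the source `t_R(r) a ⊗ b = a ⊗ b t_R(r)`. -/
def SameBase.beta (h : SameBase H G) : Ten (lm G.tt) (rm G.tt) →+ H.LTen :=
  Ten.lift (fun x y => H.mulR x 1 (H.γ y)) (fun x x₁ y => H.mulR_add_left x x₁ 1 _)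
    (fun x y y₁ => by rw [map_add, map_add])
    (fun r x y => by
      rw [rm_apply, lm_apply, h.γL_mul_tR, actL_rm_eq, BaseMaps.mulR_mulR, one_mul])

/-- The Galois form: compatible left and right bialgebroids with bijective `α` and `β`. -/
structure IsGaloisForm (H : LeftBialgebroid A L) (G : RightBialgebroid A R) : Prop
    extends IsCompatible H G where
  alpha_bij : Function.Bijective toSameBase.alpha
  beta_bij : Function.Bijective toSameBase.beta

/-- The Galois map `a ⊗ b ↦ a₁ ⊗ a₂ b` of a left bialgebroid, defined on the tensor product of
`A` with itself over `Lᵒᵖ`, where `a t(l) ⊗ b = a ⊗ t(l) b`. -/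
def galoisMap (H : LeftBialgebroid A L) : Ten (rm H.tt) (lm H.tt) →+ H.LTen :=
  Ten.lift (fun x y => H.mulR 1 y (H.γ x)) (fun x x₁ y => by rw [map_add, map_add])
    (fun x y y₁ => H.mulR_add_right 1 y y₁ _)
    (fun l x y => by
      rw [rm_apply, lm_apply, H.γ_mul_t, BaseMaps.mulR_mulR, one_mul])

/-- A left bialgebroid is a `×_L`-Hopf algebra in the sense of Schauenburg if its Galois map is
bijective. -/
def IsTimesHopfAlgebra (H : LeftBialgebroid A L) : Prop := Function.Bijective (galoisMap H)

end HopfIII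

end BohmSzlachanyi

/-!
Notation: `s_L, t_L, s_R, t_R` are the source and target maps, `γ_L(a) = a₁ ⊗ a₂` and
`γ_R(a) = a¹ ⊗ a²`; in `S(a₁)₁ a₂ ⊗ S(a₁)₂` and the like the outer indices are those of `γ_L`.

The equivalences come from a dictionary between antipodes and inverses of the Galois maps `α` and
`β`. If `S` is an antipode, then `α⁻¹(a ⊗ b) = a¹ ⊗ S(a²) b` and
`β⁻¹(a ⊗ b) = S⁻¹(b¹) a ⊗ b²`; conversely `S(a)` is obtained from `α⁻¹(a ⊗ 1)` by applying
`x ⊗ y ↦ s_R(π_R(x)) y`, and `S⁻¹(a)` from `β⁻¹(1 ⊗ a)` in the mirrored way. The two mixed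
coassociativity laws say that `α` and `β` are compatible with the coproducts, and every computation
in Sweedler notation is one application of such a law to a functional of three variables
(`MixedLR.eval`, `MixedRL.eval`, `LeftBialgebroid.coassoc_eval`).

* Hopf algebroid to Lu-style form (`IsHopfAlgebroid.isLuForm`). The two axioms say precisely that
  `x ⊗ y ↦ S⁻¹(S(x)₂) ⊗ S(x)₁ y` and `x ⊗ y ↦ S⁻¹(y)₂ x ⊗ S(S⁻¹(y)₁)` invert `α` and `β`. Applying
  counits to them gives `S(a₁) a₂ = t_L(π_L(S(a)))` and shows that `θ` is bijective. The right
  bialgebroid is `H` transported through the anti-automorphism `S` (`LuBase.rightBialgebroid`). The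
  inverse of `β` gives one mixed law, hence a formula for the inverse of `α`, which in turn gives
  the other mixed law and the equality of the two candidates for `γ_R`.
* Lu-style to symmetric form (`IsLuForm.isSymmetricForm`). The same transported right bialgebroid
  serves; both antipode identities are the condition `S(a₁) a₂ = t_L(π_L(S(a)))` read through the
  two expressions for `γ_R`.
* Symmetric form to Hopf algebroid (`IsSymmetricForm.isHopfAlgebroid`). The antipode identities make
  `α` surjective, which forces `S` to be anti-multiplicative (`SameBase.antipode_mul`); the axioms
  then follow by expanding `a₂ ⊗ 1` as `α(a₂¹ ⊗ S(a₂²))`, and its mirror image.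
* Galois form to symmetric form (`IsGaloisForm.exists_isSymmetricForm`). The formulas above define
  `S` and a candidate for `S⁻¹`, each satisfying a pair of antipode identities; these identities
  show that the two maps are mutually inverse.

The `×_L`-Hopf property is the bijectivity of `α`, since `s_R` and `t_L` have the same image.
-/

namespace BohmSzlachanyi

/-! ### Threefold tensor products and evaluation of the coassociativity laws -/

section TensorInduction

variable {I M N : Type*} [AddCommGroup M] [AddCommGroup N]

@[elab_as_elim]
theorem Ten.ind {ρ : I → M →+ M} {σ : I → N →+ N} {C : Ten ρ σ → Prop} (z : Ten ρ σ)
    (tmul : ∀ m n, C (Ten.tmul ρ σ m n)) (add : ∀ x y, C x → C y → C (x + y)) : C z := by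
  obtain ⟨w, rfl⟩ := QuotientAddGroup.mk_surjective z
  induction w using TensorProduct.induction_on with
  | zero =>
    have h := tmul 0 0
    unfold Ten.tmul at h
    rwa [TensorProduct.zero_tmul] at h
  | tmul m n => exact tmul m n
  | add x y hx hy => exact add _ _ hx hy

variable {J P Q : Type*} [AddCommGroup P] [AddCommGroup Q] {ρ : I → M →+ M} {σ : I → N →+ N}
  {τ : J → N →+ N} {κ : J → P →+ P}

/-- The functional `x ⊗ (y ⊗ z) ↦ k z (x ⊗ y) = m x (y ⊗ z)` on a threefold tensor product.
Additivity in each variable and both balancing conditions are encoded in the two families `k` and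
`m` of additive maps and their agreement on pure tensors. -/
def Ten.triple (h : ∀ i j n, σ i (τ j n) = τ j (σ i n)) (k : P → Ten ρ σ →+ Q)
    (m : M → Ten τ κ →+ Q)
    (hkm : ∀ x y z, k z (Ten.tmul _ _ x y) = m x (Ten.tmul _ _ y z)) :
    Ten ρ (Ten.actL τ κ σ h) →+ Q :=
  Ten.lift (fun x w => m x w)
    (fun x x₁ w => by
      induction w using Ten.ind with
      | tmul y z => rw [← hkm, ← hkm, ← hkm, Ten.add_tmul, map_add]
      | add w w₁ hw hw₁ => rw [map_add, map_add, map_add, hw, hw₁]; abel)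
    (fun x w w₁ => map_add _ _ _)
    (fun l x w => by
      induction w using Ten.ind with
      | tmul y z => rw [Ten.actL_tmul, ← hkm, ← hkm, Ten.balanced]
      | add w w₁ hw hw₁ => rw [map_add, map_add, map_add, hw, hw₁])

theorem Ten.triple_assoc (h : ∀ j i n, τ j (σ i n) = σ i (τ j n)) (k : P → Ten ρ σ →+ Q)
    (m : M → Ten τ κ →+ Q)
    (hkm : ∀ x y z, k z (Ten.tmul _ _ x y) = m x (Ten.tmul _ _ y z)) (v : Ten ρ σ) (z : P) :
    Ten.triple (fun i j n => (h j i n).symm) k m hkm (Ten.assoc h (Ten.tmul _ κ v z)) = k z v := by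
  induction v using Ten.ind with
  | tmul x y => exact (hkm x y z).symm
  | add v v₁ hv hv₁ => rw [Ten.add_tmul, map_add, map_add, map_add, hv, hv₁]

end TensorInduction

section Evaluation

variable {A L R P : Type*} [Ring A] [Ring L] [Ring R] [AddCommGroup P]

/-- Coassociativity evaluated on a functional of three variables: in Sweedler notation, if
`F x y z = k z (x ⊗ y) = m x (y ⊗ z)`, then `F a₁₁ a₁₂ a₂ = F a₁ a₂₁ a₂₂`. -/
theorem LeftBialgebroid.coassoc_eval (H : LeftBialgebroid A L) {k : A → H.LTen →+ P}
    {m : A → H.LTen →+ P}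
    (hkm : ∀ x y z, k z (Ten.tmul _ _ x y) = m x (Ten.tmul _ _ y z))
    {g₁ : H.LTen →+ P} {g₂ : H.LTen →+ P}
    (h₁ : ∀ u z, g₁ (Ten.tmul _ _ u z) = k z (H.γ u))
    (h₂ : ∀ x w, g₂ (Ten.tmul _ _ x w) = m x (H.γ w)) (a : A) :
    g₁ (H.γ a) = g₂ (H.γ a) := by
  have e := congrArg (Ten.triple H.lm_s_t k m hkm) (H.coassoc a)
  have e₁ : ∀ w, Ten.triple H.lm_s_t k m hkm
      (Ten.assoc (fun j i n => (H.lm_s_t i j n).symm) (Ten.mapL H.γ H.γ_t w)) = g₁ w := by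
    intro w
    induction w using Ten.ind with
    | tmul u z => exact (Ten.triple_assoc _ k m hkm _ z).trans (h₁ u z).symm
    | add w w₁ hw hw₁ => rw [map_add, map_add, map_add, map_add, hw, hw₁]
  have e₂ : ∀ w, Ten.triple H.lm_s_t k m hkm (Ten.mapR H.γ H.γ_s w) = g₂ w := by
    intro w
    induction w using Ten.ind with
    | tmul u z => exact (h₂ u z).symm
    | add w w₁ hw hw₁ => rw [map_add, map_add, map_add, hw, hw₁]
  rw [← e₁, ← e₂, e]

variable {I : Type*} {f g : I → A} {γR : A →+ Ten (rm f) (rm g)} {H : LeftBialgebroid A L}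

/-- The first mixed coassociativity law evaluated on a functional of three variables: if
`F x y z = k z (x ⊗ y) = m x (y ⊗ z)`, then `F a¹₁ a¹₂ a² = F a₁ a₂¹ a₂²`. -/
theorem MixedLR.eval {hf hs} (h : MixedLR H f g γR hf hs) {k : A → H.LTen →+ P}
    {m : A → Ten (rm f) (rm g) →+ P}
    (hkm : ∀ x y z, k z (Ten.tmul _ _ x y) = m x (Ten.tmul _ _ y z))
    {g₁ : Ten (rm f) (rm g) →+ P} {g₂ : H.LTen →+ P}
    (h₁ : ∀ u z, g₁ (Ten.tmul _ _ u z) = k z (H.γ u))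
    (h₂ : ∀ x w, g₂ (Ten.tmul _ _ x w) = m x (γR w)) (a : A) :
    g₁ (γR a) = g₂ (H.γ a) := by
  have e := congrArg (Ten.triple (lm_rm H.s f) k m hkm) (h a)
  have e₁ : ∀ w, Ten.triple (lm_rm H.s f) k m hkm
      (Ten.assoc (rm_lm f H.s) (Ten.mapL H.γ hf w)) = g₁ w := by
    intro w
    induction w using Ten.ind with
    | tmul u z => exact (Ten.triple_assoc _ k m hkm _ z).trans (h₁ u z).symm
    | add w w₁ hw hw₁ => rw [map_add, map_add, map_add, map_add, hw, hw₁]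
  have e₂ : ∀ w, Ten.triple (lm_rm H.s f) k m hkm (Ten.mapR γR hs w) = g₂ w := by
    intro w
    induction w using Ten.ind with
    | tmul u z => exact (h₂ u z).symm
    | add w w₁ hw hw₁ => rw [map_add, map_add, map_add, hw, hw₁]
  rw [← e₁, ← e₂, e]

/-- The second mixed coassociativity law evaluated on a functional of three variables: if
`F x y z = k z (x ⊗ y) = m x (y ⊗ z)`, then `F a₁¹ a₁² a₂ = F a¹ a²₁ a²₂`. -/
theorem MixedRL.eval {hg ht} (h : MixedRL H f g γR hg ht) {k : A → Ten (rm f) (rm g) →+ P}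
    {m : A → H.LTen →+ P}
    (hkm : ∀ x y z, k z (Ten.tmul _ _ x y) = m x (Ten.tmul _ _ y z))
    {g₁ : H.LTen →+ P} {g₂ : Ten (rm f) (rm g) →+ P}
    (h₁ : ∀ u z, g₁ (Ten.tmul _ _ u z) = k z (γR u))
    (h₂ : ∀ x w, g₂ (Ten.tmul _ _ x w) = m x (H.γ w)) (a : A) :
    g₁ (H.γ a) = g₂ (γR a) := by
  have e := congrArg (Ten.triple (rm_lm g H.tt) k m hkm) (h a)
  have e₁ : ∀ w, Ten.triple (rm_lm g H.tt) k m hkm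
      (Ten.assoc (lm_rm H.tt g) (Ten.mapL γR ht w)) = g₁ w := by
    intro w
    induction w using Ten.ind with
    | tmul u z => exact (Ten.triple_assoc _ k m hkm _ z).trans (h₁ u z).symm
    | add w w₁ hw hw₁ => rw [map_add, map_add, map_add, map_add, hw, hw₁]
  have e₂ : ∀ w, Ten.triple (rm_lm g H.tt) k m hkm (Ten.mapR H.γ hg w) = g₂ w := by
    intro w
    induction w using Ten.ind with
    | tmul u z => exact (h₂ u z).symm
    | add w w₁ hw hw₁ => rw [map_add, map_add, map_add, hw, hw₁]
  rw [← e₁, ← e₂, e]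

end Evaluation

/-! ### The Galois maps of a Hopf algebroid -/

section Galois

variable {A L R : Type*} [Ring A] [Ring L] [Ring R] {H : LeftBialgebroid A L}
  {G : RightBialgebroid A R}

/-- Right multiplication by `v` on the right factor. -/
def Ten.mulSnd {I M : Type*} [AddCommGroup M] (ρ : I → M →+ M) (f : I → A) (v : A) :
    Ten ρ (lm f) →+ Ten ρ (lm f) :=
  Ten.mapR (AddMonoidHom.mulRight v) (fun _ _ => mul_assoc _ _ _)

/-- Right multiplication by `v` on the left factor. -/
def Ten.mulFst {I N : Type*} [AddCommGroup N] (f : I → A) (σ : I → N →+ N) (v : A) :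
    Ten (lm f) σ →+ Ten (lm f) σ :=
  Ten.mapL (AddMonoidHom.mulRight v) (fun _ _ => mul_assoc _ _ _)

@[simp] theorem Ten.mulSnd_tmul {I M : Type*} [AddCommGroup M] (ρ : I → M →+ M) (f : I → A)
    (v : A) (m : M) (a : A) :
    Ten.mulSnd ρ f v (Ten.tmul _ _ m a) = Ten.tmul _ _ m (a * v) := rfl

@[simp] theorem Ten.mulFst_tmul {I N : Type*} [AddCommGroup N] (f : I → A) (σ : I → N →+ N)
    (v : A) (a : A) (n : N) :
    Ten.mulFst f σ v (Ten.tmul _ _ a n) = Ten.tmul _ _ (a * v) n := rfl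

theorem SameBase.alpha_tmul (h : SameBase H G) (x y : A) :
    h.alpha (Ten.tmul _ _ x y) = H.mulR 1 y (H.γ x) :=
  Ten.lift_tmul _ _ _ _ x y

theorem SameBase.beta_tmul (h : SameBase H G) (x y : A) :
    h.beta (Ten.tmul _ _ x y) = H.mulR x 1 (H.γ y) :=
  Ten.lift_tmul _ _ _ _ x y

theorem SameBase.alpha_mulSnd (h : SameBase H G) (v : A) (w : Ten (rm G.s) (lm G.s)) :
    h.alpha (Ten.mulSnd _ _ v w) = H.mulR 1 v (h.alpha w) := by
  induction w using Ten.ind with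
  | tmul x y => rw [Ten.mulSnd_tmul, h.alpha_tmul, h.alpha_tmul, H.mulR_mulR, one_mul]
  | add w w₁ hw hw₁ => simp only [map_add, hw, hw₁]

theorem SameBase.beta_mulFst (h : SameBase H G) (v : A) (w : Ten (lm G.tt) (rm G.tt)) :
    h.beta (Ten.mulFst _ _ v w) = H.mulR v 1 (h.beta w) := by
  induction w using Ten.ind with
  | tmul x y => rw [Ten.mulFst_tmul, h.beta_tmul, h.beta_tmul, H.mulR_mulR, one_mul]
  | add w w₁ hw hw₁ => simp only [map_add, hw, hw₁]

variable {S : A ≃+ A}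

/-- The map `x ⊗ y ↦ S⁻¹(y) ⊗ x`, from the target to the source of `α`. -/
def IsHopfAlgebroid.swapSinv (hS : IsHopfAlgebroid H S) (h : SameBase H G) :
    H.LTen →+ Ten (rm G.s) (lm G.s) :=
  Ten.lift (fun x y => Ten.tmul _ _ (S.symm y) x)
    (fun x x₁ y => Ten.tmul_add _ _ _ _ _)
    (fun x y y₁ => by rw [map_add, Ten.add_tmul])
    (fun l x y => by
      obtain ⟨r, hr⟩ := h.exists_sR l
      rw [lm_apply, lm_apply, Sinv_s_mul H S hS.anti hS.S_t, ← hr]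
      exact (Ten.balanced (rm G.s) (lm G.s) r _ _).symm)

/-- The map `x ⊗ y ↦ y ⊗ S(x)`, from the target to the source of `β`. -/
def IsHopfAlgebroid.swapS (hS : IsHopfAlgebroid H S) (h : SameBase H G) :
    H.LTen →+ Ten (lm G.tt) (rm G.tt) :=
  Ten.lift (fun x y => Ten.tmul _ _ y (S x))
    (fun x x₁ y => by rw [map_add, Ten.tmul_add])
    (fun x y y₁ => Ten.add_tmul _ _ _ _ _)
    (fun l x y => by
      obtain ⟨r, hr⟩ := h.exists_tR l
      rw [lm_apply, lm_apply, S_t_mul H S hS.anti hS.S_t, ← hr]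
      exact (Ten.balanced (lm G.tt) (rm G.tt) r _ _).symm)

theorem axiomMapSinv_tmul (h : ∀ l a, S.symm (H.s l * a) = S.symm a * H.tt l) (x y : A) :
    axiomMapSinv H S h (Ten.tmul _ _ x y) = H.mulR 1 x (H.γ (S.symm y)) :=
  Ten.lift_tmul _ _ _ _ x y

theorem axiomMapS_tmul (h : ∀ l a, S (H.tt l * a) = S a * H.s l) (x y : A) :
    axiomMapS H S h (Ten.tmul _ _ x y) = H.mulR y 1 (H.γ (S x)) :=
  Ten.lift_tmul _ _ _ _ x y

theorem IsHopfAlgebroid.swapSinv_tmul (hS : IsHopfAlgebroid H S) (h : SameBase H G) (x y : A) :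
    hS.swapSinv h (Ten.tmul _ _ x y) = Ten.tmul _ _ (S.symm y) x :=
  Ten.lift_tmul _ _ _ _ x y

theorem IsHopfAlgebroid.swapS_tmul (hS : IsHopfAlgebroid H S) (h : SameBase H G) (x y : A) :
    hS.swapS h (Ten.tmul _ _ x y) = Ten.tmul _ _ y (S x) :=
  Ten.lift_tmul _ _ _ _ x y

theorem IsHopfAlgebroid.alpha_swapSinv (hS : IsHopfAlgebroid H S) (h : SameBase H G)
    (z : H.LTen) :
    h.alpha (hS.swapSinv h z) = axiomMapSinv H S (Sinv_s_mul H S hS.anti hS.S_t) z := by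
  induction z using Ten.ind with
  | tmul x y => rw [hS.swapSinv_tmul, h.alpha_tmul, axiomMapSinv_tmul]
  | add z z₁ hz hz₁ => simp only [map_add, hz, hz₁]

theorem IsHopfAlgebroid.beta_swapS (hS : IsHopfAlgebroid H S) (h : SameBase H G) (z : H.LTen) :
    h.beta (hS.swapS h z) = axiomMapS H S (S_t_mul H S hS.anti hS.S_t) z := by
  induction z using Ten.ind with
  | tmul x y => rw [hS.swapS_tmul, h.beta_tmul, axiomMapS_tmul]
  | add z z₁ hz hz₁ => simp only [map_add, hz, hz₁]

/-- In a Hopf algebroid, `x ⊗ y ↦ S⁻¹(S(x)₂) ⊗ S(x)₁ y` is inverse to `α`. -/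
theorem IsHopfAlgebroid.alpha_bijective (hS : IsHopfAlgebroid H S) (h : SameBase H G) :
    Function.Bijective h.alpha := by
  have e₁ : ∀ x, h.alpha (hS.swapSinv h (H.γ (S x))) = Ten.tmul _ _ x 1 := fun x => by
    rw [hS.alpha_swapSinv, hS.ax_Sinv, S.symm_apply_apply]
  let inv : H.LTen →+ Ten (rm G.s) (lm G.s) :=
    Ten.lift (fun x y => hS.swapSinv h (H.mulR y 1 (H.γ (S x))))
      (fun x x₁ y => by simp only [map_add])
      (fun x y y₁ => by rw [H.mulR_add_left, map_add])
      (fun l x y => by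
        rw [lm_apply, lm_apply, S_t_mul H S hS.anti hS.S_t, H.γ_mul_s, H.mulR_mulR, one_mul])
  have inv_tmul : ∀ x y, inv (Ten.tmul _ _ x y) = hS.swapSinv h (H.mulR y 1 (H.γ (S x))) :=
    Ten.lift_tmul _ _ _ _
  have e₂ : ∀ (y : A) (z : H.LTen), hS.swapSinv h (H.mulR y 1 z) =
      Ten.mulSnd _ _ y (hS.swapSinv h z) := by
    intro y z
    induction z using Ten.ind with
    | tmul u v => rw [H.mulR_tmul, mul_one, hS.swapSinv_tmul, hS.swapSinv_tmul, Ten.mulSnd_tmul]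
    | add z z₁ hz hz₁ => simp only [map_add, hz, hz₁]
  constructor
  · refine Function.LeftInverse.injective (g := inv) fun w => ?_
    induction w using Ten.ind with
    | tmul x y =>
      have e₃ : ∀ z : H.LTen, inv (H.mulR 1 y z) = Ten.mulSnd _ _ y
          (hS.swapSinv h (axiomMapS H S (S_t_mul H S hS.anti hS.S_t) z)) := by
        intro z
        induction z using Ten.ind with
        | tmul u v =>
          rw [H.mulR_tmul, mul_one, ← e₂, inv_tmul, axiomMapS_tmul, H.mulR_mulR, one_mul]
        | add z z₁ hz hz₁ => simp only [map_add, hz, hz₁]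
      rw [h.alpha_tmul, e₃, hS.ax_S, hS.swapSinv_tmul, S.symm_apply_apply, Ten.mulSnd_tmul, one_mul]
    | add w w₁ hw hw₁ => rw [map_add, map_add, hw, hw₁]
  · refine Function.RightInverse.surjective (g := inv) fun z => ?_
    induction z using Ten.ind with
    | tmul x y =>
      rw [inv_tmul, e₂, h.alpha_mulSnd, e₁, H.mulR_tmul, mul_one, one_mul]
    | add z z₁ hz hz₁ => rw [map_add, map_add, hz, hz₁]

/-- In a Hopf algebroid, `x ⊗ y ↦ S⁻¹(y)₂ x ⊗ S(S⁻¹(y)₁)` is inverse to `β`. -/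
theorem IsHopfAlgebroid.beta_bijective (hS : IsHopfAlgebroid H S) (h : SameBase H G) :
    Function.Bijective h.beta := by
  have e₁ : ∀ y, h.beta (hS.swapS h (H.γ (S.symm y))) = Ten.tmul _ _ 1 y := fun y => by
    rw [hS.beta_swapS, hS.ax_S, S.apply_symm_apply]
  let inv : H.LTen →+ Ten (lm G.tt) (rm G.tt) :=
    Ten.lift (fun x y => hS.swapS h (H.mulR 1 x (H.γ (S.symm y))))
      (fun x x₁ y => by rw [H.mulR_add_right, map_add])
      (fun x y y₁ => by simp only [map_add])
      (fun l x y => by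
        rw [lm_apply, lm_apply, Sinv_s_mul H S hS.anti hS.S_t, H.γ_mul_t, H.mulR_mulR, one_mul])
  have inv_tmul : ∀ x y, inv (Ten.tmul _ _ x y) = hS.swapS h (H.mulR 1 x (H.γ (S.symm y))) :=
    Ten.lift_tmul _ _ _ _
  have e₂ : ∀ (x : A) (z : H.LTen), hS.swapS h (H.mulR 1 x z) =
      Ten.mulFst _ _ x (hS.swapS h z) := by
    intro x z
    induction z using Ten.ind with
    | tmul u v => rw [H.mulR_tmul, mul_one, hS.swapS_tmul, hS.swapS_tmul, Ten.mulFst_tmul]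
    | add z z₁ hz hz₁ => simp only [map_add, hz, hz₁]
  constructor
  · refine Function.LeftInverse.injective (g := inv) fun w => ?_
    induction w using Ten.ind with
    | tmul x y =>
      have e₃ : ∀ z : H.LTen, inv (H.mulR x 1 z) = Ten.mulFst _ _ x
          (hS.swapS h (axiomMapSinv H S (Sinv_s_mul H S hS.anti hS.S_t) z)) := by
        intro z
        induction z using Ten.ind with
        | tmul u v =>
          rw [H.mulR_tmul, mul_one, ← e₂, inv_tmul, axiomMapSinv_tmul, H.mulR_mulR, one_mul]
        | add z z₁ hz hz₁ => simp only [map_add, hz, hz₁]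
      rw [h.beta_tmul, e₃, hS.ax_Sinv, hS.swapS_tmul, S.apply_symm_apply, Ten.mulFst_tmul, one_mul]
    | add w w₁ hw hw₁ => rw [map_add, map_add, hw, hw₁]
  · refine Function.RightInverse.surjective (g := inv) fun z => ?_
    induction z using Ten.ind with
    | tmul x y =>
      rw [inv_tmul, e₂, h.beta_mulFst, e₁, H.mulR_tmul, mul_one, one_mul]
    | add z z₁ hz hz₁ => rw [map_add, map_add, hz, hz₁]

/-- The Galois map of `H` differs from `α` only in the ring over which its source is formed. -/
theorem SameBase.galoisMap_bijective (h : SameBase H G) (ha : Function.Bijective h.alpha) :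
    IsTimesHopfAlgebra H := by
  -- The relations in the two sources agree because `s_R` and `t_L` have the same image.
  let φ : Ten (rm H.tt) (lm H.tt) →+ Ten (rm G.s) (lm G.s) :=
    Ten.lift (fun x y => Ten.tmul _ _ x y) (fun _ _ _ => Ten.add_tmul _ _ _ _ _)
      (fun _ _ _ => Ten.tmul_add _ _ _ _ _)
      (fun l x y => by
        obtain ⟨r, hr⟩ := h.exists_sR l
        rw [rm_apply, lm_apply, ← hr]
        exact Ten.balanced (rm G.s) (lm G.s) r x y)
  let ψ : Ten (rm G.s) (lm G.s) →+ Ten (rm H.tt) (lm H.tt) :=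
    Ten.lift (fun x y => Ten.tmul _ _ x y) (fun _ _ _ => Ten.add_tmul _ _ _ _ _)
      (fun _ _ _ => Ten.tmul_add _ _ _ _ _)
      (fun r x y => by
        obtain ⟨l, hl⟩ := h.exists_tL r
        rw [rm_apply, lm_apply, ← hl]
        exact Ten.balanced (rm H.tt) (lm H.tt) l x y)
  have hφ' : ∀ x y, φ (Ten.tmul _ _ x y) = Ten.tmul _ _ x y := Ten.lift_tmul _ _ _ _
  have hψ' : ∀ x y, ψ (Ten.tmul _ _ x y) = Ten.tmul _ _ x y := Ten.lift_tmul _ _ _ _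
  have hφ : Function.Bijective φ :=
    Function.bijective_iff_has_inverse.mpr
      ⟨ψ, fun w => Ten.hom_ext (f := ψ.comp φ) (g := AddMonoidHom.id _)
          (fun x y => by rw [AddMonoidHom.comp_apply, hφ', hψ', AddMonoidHom.id_apply]) w,
        fun w => Ten.hom_ext (f := φ.comp ψ) (g := AddMonoidHom.id _)
          (fun x y => by rw [AddMonoidHom.comp_apply, hψ', hφ', AddMonoidHom.id_apply]) w⟩
  have e : ⇑(galoisMap H) = h.alpha ∘ φ :=
    funext fun w => Ten.hom_ext (f := galoisMap H) (g := h.alpha.comp φ)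
      (fun x y => by
        rw [AddMonoidHom.comp_apply, hφ', h.alpha_tmul]
        exact Ten.lift_tmul _ _ _ _ x y) w
  unfold IsTimesHopfAlgebra
  rw [e]
  exact ha.comp hφ

end Galois

/-! ### Counits and convolution-type maps -/

section Convolution

variable {A L R : Type*} [Ring A] [Ring L] [Ring R]

/-- The map `n ↦ m ⊗ n`. -/
def Ten.mk {I M N : Type*} [AddCommGroup M] [AddCommGroup N] (ρ : I → M →+ M) (σ : I → N →+ N)
    (m : M) : N →+ Ten ρ σ :=
  AddMonoidHom.mk' (fun n => Ten.tmul ρ σ m n) (Ten.tmul_add ρ σ m)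

/-- The map `m ↦ m ⊗ n`. -/
def Ten.mkFlip {I M N : Type*} [AddCommGroup M] [AddCommGroup N] (ρ : I → M →+ M)
    (σ : I → N →+ N) (n : N) : M →+ Ten ρ σ :=
  AddMonoidHom.mk' (fun m => Ten.tmul ρ σ m n) (fun m m₁ => Ten.add_tmul ρ σ m m₁ n)

@[simp] theorem Ten.mk_apply {I M N : Type*} [AddCommGroup M] [AddCommGroup N] (ρ : I → M →+ M)
    (σ : I → N →+ N) (m : M) (n : N) : Ten.mk ρ σ m n = Ten.tmul ρ σ m n := rfl

@[simp] theorem Ten.mkFlip_apply {I M N : Type*} [AddCommGroup M] [AddCommGroup N]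
    (ρ : I → M →+ M) (σ : I → N →+ N) (m : M) (n : N) :
    Ten.mkFlip ρ σ n m = Ten.tmul ρ σ m n := rfl

/-- The map `x ⊗ y ↦ s(π(x)) y`. -/
def LeftBialgebroid.epsL (H : LeftBialgebroid A L) : H.LTen →+ A :=
  Ten.lift (fun x y => H.s (H.π x) * y)
    (fun x x₁ y => by rw [map_add, map_add, add_mul]) (fun x y y₁ => mul_add _ _ _)
    (fun l x y => by rw [lm_apply, lm_apply, H.π_t, map_mul, mul_assoc])

theorem BaseMaps.tt_add {K : Type*} [Ring K] (H : BaseMaps A K) (k k₁ : K) :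
    H.tt (k + k₁) = H.tt k + H.tt k₁ := by
  unfold BaseMaps.tt; rw [MulOpposite.op_add, map_add]

theorem BaseMaps.tt_mul {K : Type*} [Ring K] (H : BaseMaps A K) (k k₁ : K) :
    H.tt (k * k₁) = H.tt k₁ * H.tt k := by
  unfold BaseMaps.tt; rw [MulOpposite.op_mul, map_mul]

theorem BaseMaps.tt_one {K : Type*} [Ring K] (H : BaseMaps A K) : H.tt 1 = 1 := map_one H.t

/-- The map `x ⊗ y ↦ t(π(y)) x`. -/
def LeftBialgebroid.epsR (H : LeftBialgebroid A L) : H.LTen →+ A :=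
  Ten.lift (fun x y => H.tt (H.π y) * x)
    (fun x x₁ y => mul_add _ _ _)
    (fun x y y₁ => by rw [map_add, H.tt_add, add_mul])
    (fun l x y => by rw [lm_apply, lm_apply, H.π_s, H.tt_mul, mul_assoc])

/-- The map `x ⊗ y ↦ y t(π(x))`. -/
def RightBialgebroid.epsL (G : RightBialgebroid A R) : G.RTen →+ A :=
  Ten.lift (fun x y => y * G.tt (G.π x))
    (fun x x₁ y => by rw [map_add, G.tt_add, mul_add])
    (fun x y y₁ => add_mul _ _ _)
    (fun r x y => by rw [rm_apply, rm_apply, G.π_s, G.tt_mul, mul_assoc])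

/-- The map `x ⊗ y ↦ x s(π(y))`. -/
def RightBialgebroid.epsR (G : RightBialgebroid A R) : G.RTen →+ A :=
  Ten.lift (fun x y => x * G.s (G.π y))
    (fun x x₁ y => add_mul _ _ _) (fun x y y₁ => by rw [map_add, map_add, mul_add])
    (fun r x y => by rw [rm_apply, rm_apply, G.π_t, map_mul, mul_assoc])

theorem LeftBialgebroid.epsL_tmul (H : LeftBialgebroid A L) (x y : A) :
    H.epsL (Ten.tmul _ _ x y) = H.s (H.π x) * y := Ten.lift_tmul _ _ _ _ x y

theorem LeftBialgebroid.epsR_tmul (H : LeftBialgebroid A L) (x y : A) :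
    H.epsR (Ten.tmul _ _ x y) = H.tt (H.π y) * x := Ten.lift_tmul _ _ _ _ x y

theorem RightBialgebroid.epsL_tmul (G : RightBialgebroid A R) (x y : A) :
    G.epsL (Ten.tmul _ _ x y) = y * G.tt (G.π x) := Ten.lift_tmul _ _ _ _ x y

theorem RightBialgebroid.epsR_tmul (G : RightBialgebroid A R) (x y : A) :
    G.epsR (Ten.tmul _ _ x y) = x * G.s (G.π y) := Ten.lift_tmul _ _ _ _ x y

theorem LeftBialgebroid.epsL_γ (H : LeftBialgebroid A L) (a : A) : H.epsL (H.γ a) = a :=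
  H.counit_left a

theorem LeftBialgebroid.epsR_γ (H : LeftBialgebroid A L) (a : A) : H.epsR (H.γ a) = a :=
  H.counit_right a

theorem RightBialgebroid.epsL_γ (G : RightBialgebroid A R) (a : A) : G.epsL (G.γ a) = a :=
  G.counit_left a

theorem RightBialgebroid.epsR_γ (G : RightBialgebroid A R) (a : A) : G.epsR (G.γ a) = a :=
  G.counit_right a

theorem LeftBialgebroid.epsL_mulR (H : LeftBialgebroid A L) (v : A) (z : H.LTen) :
    H.epsL (H.mulR 1 v z) = H.epsL z * v := by
  induction z using Ten.ind with
  | tmul x y => rw [H.mulR_tmul, H.epsL_tmul, H.epsL_tmul, mul_one, mul_assoc]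
  | add z z₁ hz hz₁ => rw [map_add, map_add, map_add, add_mul, hz, hz₁]

theorem LeftBialgebroid.epsR_mulR (H : LeftBialgebroid A L) (v : A) (z : H.LTen) :
    H.epsR (H.mulR v 1 z) = H.epsR z * v := by
  induction z using Ten.ind with
  | tmul x y => rw [H.mulR_tmul, H.epsR_tmul, H.epsR_tmul, mul_one, mul_assoc]
  | add z z₁ hz hz₁ => rw [map_add, map_add, map_add, add_mul, hz, hz₁]

theorem BaseMaps.prodL_tmul {K : Type*} [Ring K] (H : BaseMaps A K) (z : H.LTen)
    (hz : H.IsTakeuchiL z) (u v : A) : H.prodL z hz (Ten.tmul _ _ u v) = H.mulR u v z :=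
  Ten.lift_tmul _ _ _ _ u v

theorem BaseMaps.prodL_mulR {K : Type*} [Ring K] (H : BaseMaps A K) (z : H.LTen)
    (hz : H.IsTakeuchiL z) (u v : A) (w : H.LTen) :
    H.prodL z hz (H.mulR u v w) = H.mulR u v (H.prodL z hz w) := by
  induction w using Ten.ind with
  | tmul x y => rw [H.mulR_tmul, H.prodL_tmul, H.prodL_tmul, H.mulR_mulR]
  | add w w₁ hw hw₁ => simp only [map_add, hw, hw₁]

theorem LeftBialgebroid.prodL_mulR_γ (H : LeftBialgebroid A L) (a b u v : A) :
    H.prodL (H.γ a) (H.takeuchi a) (H.mulR u v (H.γ b)) = H.mulR u v (H.γ (a * b)) := by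
  rw [H.prodL_mulR, ← H.γ_mul]

/-- The map `x ⊗ y ↦ S(x) y` on `A_L ⊗ _LA`. -/
def LeftBialgebroid.convS (H : LeftBialgebroid A L) (S : A →+ A)
    (hS : ∀ l a, S (H.tt l * a) = S a * H.s l) : H.LTen →+ A :=
  Ten.lift (fun x y => S x * y) (fun x x₁ y => by rw [map_add, add_mul])
    (fun x y y₁ => mul_add _ _ _)
    (fun l x y => by rw [lm_apply, lm_apply, hS, mul_assoc])

/-- The map `x ⊗ y ↦ T(y) x` on `A_L ⊗ _LA`. -/
def LeftBialgebroid.convT (H : LeftBialgebroid A L) (T : A →+ A)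
    (hT : ∀ l a, T (H.s l * a) = T a * H.tt l) : H.LTen →+ A :=
  Ten.lift (fun x y => T y * x) (fun x x₁ y => mul_add _ _ _)
    (fun x y y₁ => by rw [map_add, add_mul])
    (fun l x y => by rw [lm_apply, lm_apply, hT, mul_assoc])

/-- The map `x ⊗ y ↦ x S(y)` on `A^R ⊗ ^RA`. -/
def RightBialgebroid.convS (G : RightBialgebroid A R) (S : A →+ A)
    (hS : ∀ r a, S (a * G.tt r) = G.s r * S a) : G.RTen →+ A :=
  Ten.lift (fun x y => x * S y) (fun x x₁ y => add_mul _ _ _)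
    (fun x y y₁ => by rw [map_add, mul_add])
    (fun r x y => by rw [rm_apply, rm_apply, hS, mul_assoc])

/-- The map `x ⊗ y ↦ y T(x)` on `A^R ⊗ ^RA`. -/
def RightBialgebroid.convT (G : RightBialgebroid A R) (T : A →+ A)
    (hT : ∀ r a, T (a * G.s r) = G.tt r * T a) : G.RTen →+ A :=
  Ten.lift (fun x y => y * T x) (fun x x₁ y => by rw [map_add, mul_add])
    (fun x y y₁ => add_mul _ _ _)
    (fun r x y => by rw [rm_apply, rm_apply, hT, mul_assoc])

variable {H : LeftBialgebroid A L} {G : RightBialgebroid A R} {S T : A →+ A}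

theorem LeftBialgebroid.convS_tmul (hS : ∀ l a, S (H.tt l * a) = S a * H.s l) (x y : A) :
    H.convS S hS (Ten.tmul _ _ x y) = S x * y := Ten.lift_tmul _ _ _ _ x y

theorem LeftBialgebroid.convT_tmul (hT : ∀ l a, T (H.s l * a) = T a * H.tt l) (x y : A) :
    H.convT T hT (Ten.tmul _ _ x y) = T y * x := Ten.lift_tmul _ _ _ _ x y

theorem RightBialgebroid.convS_tmul (hS : ∀ r a, S (a * G.tt r) = G.s r * S a) (x y : A) :
    G.convS S hS (Ten.tmul _ _ x y) = x * S y := Ten.lift_tmul _ _ _ _ x y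

theorem RightBialgebroid.convT_tmul (hT : ∀ r a, T (a * G.s r) = G.tt r * T a) (x y : A) :
    G.convT T hT (Ten.tmul _ _ x y) = y * T x := Ten.lift_tmul _ _ _ _ x y

theorem LeftBialgebroid.convS_mulR (hS : ∀ l a, S (H.tt l * a) = S a * H.s l) (v : A)
    (z : H.LTen) : H.convS S hS (H.mulR 1 v z) = H.convS S hS z * v := by
  induction z using Ten.ind with
  | tmul x y => rw [H.mulR_tmul, H.convS_tmul, H.convS_tmul, mul_one, mul_assoc]
  | add z z₁ hz hz₁ => rw [map_add, map_add, map_add, add_mul, hz, hz₁]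

theorem LeftBialgebroid.convT_mulR (hT : ∀ l a, T (H.s l * a) = T a * H.tt l) (v : A)
    (z : H.LTen) : H.convT T hT (H.mulR v 1 z) = H.convT T hT z * v := by
  induction z using Ten.ind with
  | tmul x y => rw [H.mulR_tmul, H.convT_tmul, H.convT_tmul, mul_one, mul_assoc]
  | add z z₁ hz hz₁ => rw [map_add, map_add, map_add, add_mul, hz, hz₁]

theorem RightBialgebroid.π_src (G : RightBialgebroid A R) (r : R) : G.π (G.s r) = r := by
  rw [← one_mul (G.s r), G.π_s, G.π_one, one_mul]

theorem RightBialgebroid.π_tgt (G : RightBialgebroid A R) (r : R) : G.π (G.tt r) = r := by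
  rw [← one_mul (G.tt r), G.π_t, G.π_one, mul_one]

theorem LeftBialgebroid.π_src (H : LeftBialgebroid A L) (l : L) : H.π (H.s l) = l := by
  rw [← mul_one (H.s l), H.π_s, H.π_one, mul_one]

theorem LeftBialgebroid.π_tgt (H : LeftBialgebroid A L) (l : L) : H.π (H.tt l) = l := by
  rw [← mul_one (H.tt l), H.π_t, H.π_one, one_mul]

end Convolution

section Antipode

variable {A L R : Type*} [Ring A] [Ring L] [Ring R] {H : LeftBialgebroid A L}
  {G : RightBialgebroid A R} {S T : A →+ A}

theorem LeftBialgebroid.conv_S_one (hS : ∀ l a, S (H.tt l * a) = S a * H.s l)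
    (hc : ∀ a, H.convS S hS (H.γ a) = G.s (G.π a)) : S 1 = 1 := by
  have e := hc 1
  rwa [H.γ_one, H.convS_tmul, mul_one, G.π_one, map_one G.s] at e

theorem LeftBialgebroid.conv_T_one (hT : ∀ l a, T (H.s l * a) = T a * H.tt l)
    (hc : ∀ a, H.convT T hT (H.γ a) = G.tt (G.π a)) : T 1 = 1 := by
  have e := hc 1
  rwa [H.γ_one, H.convT_tmul, mul_one, G.π_one, G.tt_one] at e

theorem SameBase.S_tR (h : SameBase H G) (hS : ∀ l a, S (H.tt l * a) = S a * H.s l)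
    (hc : ∀ a, H.convS S hS (H.γ a) = G.s (G.π a)) (r : R) : S (G.tt r) = G.s r := by
  have e := hc (G.tt r)
  obtain ⟨l, hl⟩ := h.exists_sL r
  rw [G.π_tgt] at e
  rw [← e, ← hl, H.γ_src, H.convS_tmul, mul_one]

theorem SameBase.T_sR (h : SameBase H G) (hT : ∀ l a, T (H.s l * a) = T a * H.tt l)
    (hc : ∀ a, H.convT T hT (H.γ a) = G.tt (G.π a)) (r : R) : T (G.s r) = G.tt r := by
  have e := hc (G.s r)
  obtain ⟨l, hl⟩ := h.exists_tL r
  rw [G.π_src] at e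
  rw [← e, ← hl, H.γ_tgt, H.convT_tmul, mul_one]

end Antipode

/-! ### Antipode identities and the Galois maps -/

section Antipode

variable {A L R : Type*} [Ring A] [Ring L] [Ring R] {H : LeftBialgebroid A L}
  {G : RightBialgebroid A R} {S T : A →+ A}

/-- An antipode is anti-multiplicative as soon as `α` is surjective. Both `S(xb)y` and
`S(b)S(x)y` are additive in `x ⊗ y`, and they agree on `α(x ⊗ y)`: writing `b ⊗ 1` as a sum of
elements `α(p ⊗ q)`, both become sums of the elements `s_R(π_R(xp)) q y`. -/
theorem SameBase.antipode_mul (h : SameBase H G) (hα : Function.Surjective h.alpha)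
    (hS : ∀ l a, S (H.tt l * a) = S a * H.s l)
    (hc : ∀ a, H.convS S hS (H.γ a) = G.s (G.π a)) (a b : A) : S (a * b) = S b * S a := by
  have e₁ : ∀ x y, H.convS S hS (H.mulR b y (H.γ x)) = S b * G.s (G.π x) * y := by
    intro x y
    obtain ⟨l, hl⟩ := h.exists_tL (G.π x)
    have key : ∀ z : H.LTen, H.convS S hS (H.prodL (H.γ x) (H.takeuchi x) z) =
        H.convS S hS (Ten.actR (lm H.tt) (lm H.s) (lm H.tt)
          (fun j i n => (H.lm_s_t i j n).symm) l z) := by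
      intro z
      obtain ⟨w, rfl⟩ := hα z
      induction w using Ten.ind with
      | tmul p q =>
        have e : ∀ z : H.LTen, Ten.actR (lm H.tt) (lm H.s) (lm H.tt)
            (fun j i n => (H.lm_s_t i j n).symm) l (H.mulR 1 q z) = H.mulR 1 q
            (Ten.actR (lm H.tt) (lm H.s) (lm H.tt) (fun j i n => (H.lm_s_t i j n).symm) l z) := by
          intro z
          induction z using Ten.ind with
          | tmul u v =>
            rw [H.mulR_tmul, Ten.actR_tmul, Ten.actR_tmul, H.mulR_tmul, lm_apply, lm_apply,
              mul_assoc]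
          | add z z₁ hz hz₁ => simp only [map_add, hz, hz₁]
        rw [h.alpha_tmul, H.prodL_mulR_γ, e, ← H.γ_t, H.convS_mulR, H.convS_mulR, hc, hc, hl,
          G.π_mul_s]
      | add w w₁ hw hw₁ => simp only [map_add, hw, hw₁]
    have e := key (Ten.tmul _ _ b 1)
    rw [H.prodL_tmul, Ten.actR_tmul, H.convS_tmul, lm_apply, mul_one, hl] at e
    rw [← e, ← H.convS_mulR, H.mulR_mulR, mul_one, one_mul]
  have e₂ : ∀ z : H.LTen, H.convS S hS (H.mulR b 1 z) = S b * H.convS S hS z := by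
    intro z
    obtain ⟨w, rfl⟩ := hα z
    induction w using Ten.ind with
    | tmul x y => rw [h.alpha_tmul, H.mulR_mulR, one_mul, mul_one, e₁, H.convS_mulR, hc, mul_assoc]
    | add w w₁ hw hw₁ => rw [map_add, map_add, map_add, map_add, mul_add, hw, hw₁]
  have e := e₂ (Ten.tmul _ _ a 1)
  rwa [H.mulR_tmul, H.convS_tmul, H.convS_tmul, mul_one, mul_one, mul_one] at e

/-- The mirror image of `SameBase.antipode_mul`, for an inverse antipode and `β`. -/
theorem SameBase.antipodeInv_mul (h : SameBase H G) (hβ : Function.Surjective h.beta)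
    (hT : ∀ l a, T (H.s l * a) = T a * H.tt l)
    (hc : ∀ a, H.convT T hT (H.γ a) = G.tt (G.π a)) (a b : A) : T (a * b) = T b * T a := by
  have e₁ : ∀ x y, H.convT T hT (H.mulR y b (H.γ x)) = T b * G.tt (G.π x) * y := by
    intro x y
    obtain ⟨l, hl⟩ := h.exists_sL (G.π x)
    have key : ∀ z : H.LTen, H.convT T hT (H.prodL (H.γ x) (H.takeuchi x) z) =
        H.convT T hT (Ten.actL (lm H.tt) (lm H.s) (lm H.s) H.lm_s_t l z) := by
      intro z
      obtain ⟨w, rfl⟩ := hβ z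
      induction w using Ten.ind with
      | tmul q p =>
        have e : ∀ z : H.LTen, Ten.actL (lm H.tt) (lm H.s) (lm H.s) H.lm_s_t l (H.mulR q 1 z) =
            H.mulR q 1 (Ten.actL (lm H.tt) (lm H.s) (lm H.s) H.lm_s_t l z) := by
          intro z
          induction z using Ten.ind with
          | tmul u v =>
            rw [H.mulR_tmul, Ten.actL_tmul, Ten.actL_tmul, H.mulR_tmul, lm_apply, lm_apply,
              mul_assoc]
          | add z z₁ hz hz₁ => simp only [map_add, hz, hz₁]
        rw [h.beta_tmul, H.prodL_mulR_γ, e, ← H.γ_s, H.convT_mulR, H.convT_mulR, hc, hc, hl,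
          G.π_mul_t]
      | add w w₁ hw hw₁ => simp only [map_add, hw, hw₁]
    have e := key (Ten.tmul _ _ 1 b)
    rw [H.prodL_tmul, Ten.actL_tmul, H.convT_tmul, lm_apply, mul_one, hl] at e
    rw [← e, ← H.convT_mulR, H.mulR_mulR, mul_one, one_mul]
  have e₂ : ∀ z : H.LTen, H.convT T hT (H.mulR 1 b z) = T b * H.convT T hT z := by
    intro z
    obtain ⟨w, rfl⟩ := hβ z
    induction w using Ten.ind with
    | tmul x y => rw [h.beta_tmul, H.mulR_mulR, one_mul, mul_one, e₁, H.convT_mulR, hc, mul_assoc]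
    | add w w₁ hw hw₁ => rw [map_add, map_add, map_add, map_add, mul_add, hw, hw₁]
  have e := e₂ (Ten.tmul _ _ 1 a)
  rwa [H.mulR_tmul, H.convT_tmul, H.convT_tmul, mul_one, mul_one, mul_one] at e

/-- The map `id ⊗ S : A^R ⊗ ^RA → A^R ⊗ _RA`. -/
def RightBialgebroid.idS (G : RightBialgebroid A R) (S : A →+ A)
    (hS : ∀ r a, S (a * G.tt r) = G.s r * S a) : G.RTen →+ Ten (rm G.s) (lm G.s) :=
  Ten.mapR S hS

/-- The map `T ⊗ id : A^R ⊗ ^RA → A_R ⊗ ^RA`. -/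
def RightBialgebroid.idT (G : RightBialgebroid A R) (T : A →+ A)
    (hT : ∀ r a, T (a * G.s r) = G.tt r * T a) : G.RTen →+ Ten (lm G.tt) (rm G.tt) :=
  Ten.mapL T hT

theorem RightBialgebroid.idS_tmul (hS : ∀ r a, S (a * G.tt r) = G.s r * S a) (x y : A) :
    G.idS S hS (Ten.tmul _ _ x y) = Ten.tmul _ _ x (S y) :=
  Ten.mapR_tmul S hS x y

theorem RightBialgebroid.idT_tmul (hT : ∀ r a, T (a * G.s r) = G.tt r * T a) (x y : A) :
    G.idT T hT (Ten.tmul _ _ x y) = Ten.tmul _ _ (T x) y :=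
  Ten.mapL_tmul T hT x y

/-- `x ⊗ y ↦ x¹ ⊗ S(x²) y` is a left inverse of `α` when `S(a₁) a₂ = s_R(π_R(a))`; hence
`α(a¹ ⊗ S(a²)) = a ⊗ 1` as soon as `α` is surjective. -/
theorem SameBase.alpha_idS_of_surjective (h : SameBase H G)
    (hm : MixedRL H G.s G.tt G.γ h.γL_mul_tR h.γR_tL_mul) (hα : Function.Surjective h.alpha)
    (hS : ∀ l a, S (H.tt l * a) = S a * H.s l)
    (hS' : ∀ r a, S (a * G.tt r) = G.s r * S a)
    (hc : ∀ a, H.convS S hS (H.γ a) = G.s (G.π a)) (a : A) :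
    h.alpha (G.idS S hS' (G.γ a)) = Ten.tmul _ _ a 1 := by
  let Φ : H.LTen →+ Ten (rm G.s) (lm G.s) :=
    Ten.lift (fun x y => Ten.mulSnd _ _ y (G.idS S hS' (G.γ x)))
      (fun x x₁ y => by simp only [map_add])
      (fun x y y₁ => by
        generalize G.idS S hS' (G.γ x) = w
        induction w using Ten.ind with
        | tmul u v =>
          rw [Ten.mulSnd_tmul, Ten.mulSnd_tmul, Ten.mulSnd_tmul, mul_add, Ten.tmul_add]
        | add w w₁ hw hw₁ => rw [map_add, map_add, map_add, hw, hw₁]; abel)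
      (fun l x y => by
        rw [lm_apply, lm_apply, h.γR_tL_mul]
        generalize G.γ x = w
        induction w using Ten.ind with
        | tmul u v =>
          rw [Ten.actR_tmul, G.idS_tmul, G.idS_tmul, Ten.mulSnd_tmul, Ten.mulSnd_tmul, lm_apply,
            hS, mul_assoc]
        | add w w₁ hw hw₁ => simp only [map_add, hw, hw₁])
  have hΦ : ∀ x y, Φ (Ten.tmul _ _ x y) = Ten.mulSnd _ _ y (G.idS S hS' (G.γ x)) :=
    Ten.lift_tmul _ _ _ _
  have e : ∀ w, Φ (h.alpha w) = w := by
    intro w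
    induction w using Ten.ind with
    | tmul x y =>
      rw [h.alpha_tmul]
      have e := hm.eval (k := fun z => (Ten.mulSnd _ _ (z * y)).comp (G.idS S hS'))
        (m := fun x => (Ten.mk (rm G.s) (lm G.s) x).comp
          ((AddMonoidHom.mulRight y).comp (H.convS S hS)))
        (g₁ := Φ.comp (H.mulR 1 y)) (g₂ := (Ten.mkFlip _ _ y).comp G.epsR)
        (fun u v z => by
          simp only [AddMonoidHom.comp_apply, G.idS_tmul, Ten.mulSnd_tmul, H.convS_tmul,
            Ten.mk_apply, AddMonoidHom.coe_mulRight, mul_assoc])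
        (fun u z => by
          rw [AddMonoidHom.comp_apply, H.mulR_tmul, mul_one, hΦ]; rfl)
        (fun u v => by
          rw [AddMonoidHom.comp_apply, G.epsR_tmul, AddMonoidHom.comp_apply,
            AddMonoidHom.comp_apply, hc, Ten.mkFlip_apply, Ten.mk_apply]
          exact Ten.balanced (rm G.s) (lm G.s) _ u y) x
      rw [AddMonoidHom.comp_apply, AddMonoidHom.comp_apply, G.epsR_γ] at e
      exact e
    | add w w₁ hw hw₁ => rw [map_add, map_add, hw, hw₁]
  obtain ⟨w, hw⟩ := hα (Ten.tmul _ _ a 1)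
  have e₁ := e w
  rw [hw, hΦ] at e₁
  rw [← hw, ← e₁, h.alpha_mulSnd, H.mulR_one]

/-- The mirror image of `SameBase.alpha_idS_of_surjective`: `x ⊗ y ↦ T(y¹) x ⊗ y²` is a left
inverse of `β` when `T(a₂) a₁ = t_R(π_R(a))`. -/
theorem SameBase.beta_idT_of_surjective (h : SameBase H G)
    (hm : MixedLR H G.s G.tt G.γ h.γL_mul_sR h.γR_sL_mul) (hβ : Function.Surjective h.beta)
    (hT : ∀ l a, T (H.s l * a) = T a * H.tt l)
    (hT' : ∀ r a, T (a * G.s r) = G.tt r * T a)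
    (hc : ∀ a, H.convT T hT (H.γ a) = G.tt (G.π a)) (a : A) :
    h.beta (G.idT T hT' (G.γ a)) = Ten.tmul _ _ 1 a := by
  let Φ : H.LTen →+ Ten (lm G.tt) (rm G.tt) :=
    Ten.lift (fun x y => Ten.mulFst _ _ x (G.idT T hT' (G.γ y)))
      (fun x x₁ y => by
        generalize G.idT T hT' (G.γ y) = w
        induction w using Ten.ind with
        | tmul u v =>
          rw [Ten.mulFst_tmul, Ten.mulFst_tmul, Ten.mulFst_tmul, mul_add, Ten.add_tmul]
        | add w w₁ hw hw₁ => rw [map_add, map_add, map_add, hw, hw₁]; abel)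
      (fun x y y₁ => by simp only [map_add])
      (fun l x y => by
        rw [lm_apply, lm_apply, h.γR_sL_mul]
        generalize G.γ y = w
        induction w using Ten.ind with
        | tmul u v =>
          rw [Ten.actL_tmul, G.idT_tmul, G.idT_tmul, Ten.mulFst_tmul, Ten.mulFst_tmul, lm_apply,
            hT, mul_assoc]
        | add w w₁ hw hw₁ => simp only [map_add, hw, hw₁])
  have hΦ : ∀ x y, Φ (Ten.tmul _ _ x y) = Ten.mulFst _ _ x (G.idT T hT' (G.γ y)) :=
    Ten.lift_tmul _ _ _ _
  have e : ∀ w, Φ (h.beta w) = w := by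
    intro w
    induction w using Ten.ind with
    | tmul x y =>
      rw [h.beta_tmul]
      have e := hm.eval (k := fun z => (Ten.mkFlip (lm G.tt) (rm G.tt) z).comp
          ((AddMonoidHom.mulRight x).comp (H.convT T hT)))
        (m := fun u => (Ten.mulFst _ _ (u * x)).comp (G.idT T hT'))
        (g₁ := (Ten.mk _ _ x).comp G.epsL) (g₂ := Φ.comp (H.mulR x 1))
        (fun u v z => by
          simp only [AddMonoidHom.comp_apply, G.idT_tmul, Ten.mulFst_tmul, H.convT_tmul,
            Ten.mkFlip_apply, AddMonoidHom.coe_mulRight, mul_assoc])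
        (fun u z => by
          rw [AddMonoidHom.comp_apply, G.epsL_tmul, AddMonoidHom.comp_apply,
            AddMonoidHom.comp_apply, hc, Ten.mkFlip_apply, Ten.mk_apply]
          exact (Ten.balanced (lm G.tt) (rm G.tt) _ x z).symm)
        (fun u v => by
          rw [AddMonoidHom.comp_apply, H.mulR_tmul, mul_one, hΦ]; rfl) y
      rw [AddMonoidHom.comp_apply, AddMonoidHom.comp_apply, G.epsL_γ] at e
      exact e.symm
    | add w w₁ hw hw₁ => rw [map_add, map_add, hw, hw₁]
  obtain ⟨w, hw⟩ := hβ (Ten.tmul _ _ 1 a)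
  have e₁ := e w
  rw [hw, hΦ] at e₁
  rw [← hw, ← e₁, h.beta_mulFst, H.mulR_one]

/-- `α(a¹ ⊗ S(a²)) = a ⊗ 1` when `a¹ S(a²) = s_L(π_L(a))`. -/
theorem SameBase.alpha_idS (h : SameBase H G)
    (hm : MixedLR H G.s G.tt G.γ h.γL_mul_sR h.γR_sL_mul)
    (hS' : ∀ r a, S (a * G.tt r) = G.s r * S a)
    (hc : ∀ a, G.convS S hS' (G.γ a) = H.s (H.π a)) (a : A) :
    h.alpha (G.idS S hS' (G.γ a)) = Ten.tmul _ _ a 1 := by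
  have e := hm.eval (k := fun z => H.mulR 1 (S z))
    (m := fun x => (Ten.mk (lm H.tt) (lm H.s) x).comp (G.convS S hS'))
    (g₁ := h.alpha.comp (G.idS S hS')) (g₂ := (Ten.mkFlip _ _ 1).comp H.epsR)
    (fun u v z => by
      rw [AddMonoidHom.comp_apply, G.convS_tmul, Ten.mk_apply, H.mulR_tmul, mul_one])
    (fun u z => by rw [AddMonoidHom.comp_apply, G.idS_tmul, h.alpha_tmul])
    (fun u v => by
      rw [AddMonoidHom.comp_apply, AddMonoidHom.comp_apply, H.epsR_tmul, hc, Ten.mkFlip_apply,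
        Ten.mk_apply]
      have e := Ten.balanced (lm H.tt) (lm H.s) (H.π v) u 1
      rwa [lm_apply, lm_apply, mul_one] at e) a
  rwa [AddMonoidHom.comp_apply, AddMonoidHom.comp_apply, H.epsR_γ] at e

/-- `β(T(a¹) ⊗ a²) = 1 ⊗ a` when `a² T(a¹) = t_L(π_L(a))`. -/
theorem SameBase.beta_idT (h : SameBase H G)
    (hm : MixedRL H G.s G.tt G.γ h.γL_mul_tR h.γR_tL_mul)
    (hT' : ∀ r a, T (a * G.s r) = G.tt r * T a)
    (hc : ∀ a, G.convT T hT' (G.γ a) = H.tt (H.π a)) (a : A) :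
    h.beta (G.idT T hT' (G.γ a)) = Ten.tmul _ _ 1 a := by
  have e := hm.eval (k := fun z => (Ten.mkFlip (lm H.tt) (lm H.s) z).comp (G.convT T hT'))
    (m := fun x => H.mulR (T x) 1)
    (g₁ := (Ten.mk _ _ 1).comp H.epsL) (g₂ := h.beta.comp (G.idT T hT'))
    (fun u v z => by
      rw [AddMonoidHom.comp_apply, G.convT_tmul, Ten.mkFlip_apply, H.mulR_tmul, mul_one])
    (fun u z => by
      rw [AddMonoidHom.comp_apply, AddMonoidHom.comp_apply, H.epsL_tmul, hc, Ten.mkFlip_apply,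
        Ten.mk_apply]
      have e := Ten.balanced (lm H.tt) (lm H.s) (H.π u) 1 z
      rw [lm_apply, lm_apply, mul_one] at e
      exact e.symm)
    (fun u v => by rw [AddMonoidHom.comp_apply, G.idT_tmul, h.beta_tmul]) a
  rw [AddMonoidHom.comp_apply, AddMonoidHom.comp_apply, H.epsL_γ] at e
  exact e.symm

/-- Applying `s_L π_L` to the first factor of `α(a¹ ⊗ S(a²)) = a ⊗ 1` gives the second antipode
identity. -/
theorem SameBase.mul_S_of_alpha (h : SameBase H G) (hS' : ∀ r a, S (a * G.tt r) = G.s r * S a)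
    (ha : ∀ a, h.alpha (G.idS S hS' (G.γ a)) = Ten.tmul _ _ a 1) (a : A) :
    G.convS S hS' (G.γ a) = H.s (H.π a) := by
  have e : ∀ z : G.RTen, H.epsL (h.alpha (G.idS S hS' z)) = G.convS S hS' z := by
    intro z
    induction z using Ten.ind with
    | tmul x y => rw [G.idS_tmul, h.alpha_tmul, H.epsL_mulR, H.epsL_γ, G.convS_tmul]
    | add z z₁ hz hz₁ => simp only [map_add, hz, hz₁]
  rw [← e, ha, H.epsL_tmul, mul_one]

/-- The mirror image of `SameBase.mul_S_of_alpha`. -/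
theorem SameBase.mul_T_of_beta (h : SameBase H G) (hT' : ∀ r a, T (a * G.s r) = G.tt r * T a)
    (hb : ∀ a, h.beta (G.idT T hT' (G.γ a)) = Ten.tmul _ _ 1 a) (a : A) :
    G.convT T hT' (G.γ a) = H.tt (H.π a) := by
  have e : ∀ z : G.RTen, H.epsR (h.beta (G.idT T hT' z)) = G.convT T hT' z := by
    intro z
    induction z using Ten.ind with
    | tmul x y => rw [G.idT_tmul, h.beta_tmul, H.epsR_mulR, H.epsR_γ, G.convT_tmul]
    | add z z₁ hz hz₁ => simp only [map_add, hz, hz₁]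
  rw [← e, hb, H.epsR_tmul, mul_one]

/-- `S(a₁)₁ a₂ ⊗ S(a₁)₂ = 1 ⊗ S(a)`: writing `a₂ ⊗ 1` as `α(a₂¹ ⊗ S(a₂²))`, the left-hand side
becomes `γ_L(S(a¹₁) a¹₂) (1 ⊗ S(a²)) = γ_L(s_R(π_R(a¹))) (1 ⊗ S(a²))`. -/
theorem SameBase.axiomMapS_γ {S : A ≃+ A} (h : SameBase H G)
    (hm : MixedLR H G.s G.tt G.γ h.γL_mul_sR h.γR_sL_mul)
    (hS : ∀ l a, S.toAddMonoidHom (H.tt l * a) = S.toAddMonoidHom a * H.s l)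
    (hS' : ∀ r a, S.toAddMonoidHom (a * G.tt r) = G.s r * S.toAddMonoidHom a)
    (hc : ∀ a, H.convS S.toAddMonoidHom hS (H.γ a) = G.s (G.π a))
    (ha : ∀ a, h.alpha (G.idS S.toAddMonoidHom hS' (G.γ a)) = Ten.tmul _ _ a 1) (a : A) :
    axiomMapS H S hS (H.γ a) = Ten.tmul _ _ 1 (S a) := by
  have e := hm.eval
    (k := fun z => (H.mulR 1 (S z)).comp (H.γ.comp (H.convS S.toAddMonoidHom hS)))
    (m := fun x => (H.prodL (H.γ (S x)) (H.takeuchi (S x))).comp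
      (h.alpha.comp (G.idS S.toAddMonoidHom hS')))
    (g₁ := (Ten.mk _ _ 1).comp (S.toAddMonoidHom.comp G.epsL)) (g₂ := axiomMapS H S hS)
    (fun u v z => by
      simp only [AddMonoidHom.comp_apply]
      rw [G.idS_tmul, h.alpha_tmul, H.prodL_mulR_γ, H.convS_tmul]; rfl)
    (fun u z => by
      simp only [AddMonoidHom.comp_apply]
      rw [G.epsL_tmul, hS', hc]
      obtain ⟨l, hl⟩ := h.exists_tL (G.π u)
      rw [← hl, H.γ_tgt, H.mulR_tmul, mul_one]; rfl)
    (fun u v => by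
      simp only [AddMonoidHom.comp_apply]
      rw [ha, H.prodL_tmul]
      exact axiomMapS_tmul hS u v) a
  rw [AddMonoidHom.comp_apply, AddMonoidHom.comp_apply, G.epsL_γ] at e
  exact e.symm

/-- The mirror image of `SameBase.axiomMapS_γ`. -/
theorem SameBase.axiomMapSinv_γ {S : A ≃+ A} (h : SameBase H G)
    (hm : MixedRL H G.s G.tt G.γ h.γL_mul_tR h.γR_tL_mul)
    (hT : ∀ l a, S.symm.toAddMonoidHom (H.s l * a) = S.symm.toAddMonoidHom a * H.tt l)
    (hT' : ∀ r a, S.symm.toAddMonoidHom (a * G.s r) = G.tt r * S.symm.toAddMonoidHom a)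
    (hc : ∀ a, H.convT S.symm.toAddMonoidHom hT (H.γ a) = G.tt (G.π a))
    (hb : ∀ a, h.beta (G.idT S.symm.toAddMonoidHom hT' (G.γ a)) = Ten.tmul _ _ 1 a) (a : A) :
    axiomMapSinv H S hT (H.γ a) = Ten.tmul _ _ (S.symm a) 1 := by
  have e := hm.eval
    (k := fun z => (H.prodL (H.γ (S.symm z)) (H.takeuchi (S.symm z))).comp
      (h.beta.comp (G.idT S.symm.toAddMonoidHom hT')))
    (m := fun x => (H.mulR (S.symm x) 1).comp (H.γ.comp (H.convT S.symm.toAddMonoidHom hT)))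
    (g₁ := axiomMapSinv H S hT)
    (g₂ := (Ten.mkFlip _ _ 1).comp (S.symm.toAddMonoidHom.comp G.epsR))
    (fun u v z => by
      simp only [AddMonoidHom.comp_apply]
      rw [G.idT_tmul, h.beta_tmul, H.prodL_mulR_γ, H.convT_tmul]; rfl)
    (fun u v => by
      simp only [AddMonoidHom.comp_apply]
      rw [hb, H.prodL_tmul]
      exact axiomMapSinv_tmul hT u v)
    (fun u z => by
      simp only [AddMonoidHom.comp_apply]
      rw [G.epsR_tmul, hT', hc]
      obtain ⟨l, hl⟩ := h.exists_sL (G.π z)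
      rw [← hl, H.γ_src, H.mulR_tmul, mul_one]; rfl) a
  rwa [AddMonoidHom.comp_apply, AddMonoidHom.comp_apply, G.epsR_γ] at e

end Antipode

/-! ### Mixed coassociativity from the Galois maps, and the symmetric form -/

section MixedFromGalois

variable {A L R : Type*} [Ring A] [Ring L] [Ring R] {H : LeftBialgebroid A L}
  {G : RightBialgebroid A R}

/-- The map `id ⊗ S⁻¹ : A^R ⊗ _RA → A^R ⊗ ^RA`. -/
def RightBialgebroid.idSinv (G : RightBialgebroid A R) {S : A ≃+ A}
    (hS' : ∀ r a, S.toAddMonoidHom (a * G.tt r) = G.s r * S.toAddMonoidHom a) :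
    Ten (rm G.s) (lm G.s) →+ G.RTen :=
  Ten.mapR S.symm.toAddMonoidHom (fun r y => by
    show S.symm (G.s r * y) = S.symm y * G.tt r
    rw [AddEquiv.symm_apply_eq]
    exact ((hS' r (S.symm y)).trans (congrArg (G.s r * ·) (S.apply_symm_apply y))).symm)

theorem RightBialgebroid.idSinv_tmul {S : A ≃+ A}
    (hS' : ∀ r a, S.toAddMonoidHom (a * G.tt r) = G.s r * S.toAddMonoidHom a) (x y : A) :
    G.idSinv hS' (Ten.tmul _ _ x y) = Ten.tmul _ _ x (S.symm y) := Ten.mapR_tmul _ _ x y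

theorem RightBialgebroid.idSinv_idS {S : A ≃+ A}
    (hS' : ∀ r a, S.toAddMonoidHom (a * G.tt r) = G.s r * S.toAddMonoidHom a) (z : G.RTen) :
    G.idSinv hS' (G.idS S.toAddMonoidHom hS' z) = z := by
  induction z using Ten.ind with
  | tmul x y =>
    rw [G.idS_tmul, G.idSinv_tmul]
    exact congrArg _ (S.symm_apply_apply y)
  | add z z₁ hz hz₁ => rw [map_add, map_add, hz, hz₁]

/-- The first mixed coassociativity law follows from the bijectivity of `α` and the formula
`α(a¹ ⊗ S(a²)) = a ⊗ 1`. By coassociativity of `γ_L`, the map `α`, and with it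
`δ : x ⊗ y ↦ x¹ ⊗ S⁻¹(S(x²) y)`, satisfies `(γ_L ⊗ id) ∘ δ = (id ⊗ δ) ∘ (γ_L ⊗ id)`; this is
evaluated at `a ⊗ 1`. -/
theorem SameBase.mixedLR_of_alpha (h : SameBase H G) (hα : Function.Bijective h.alpha)
    {S : A ≃+ A} (hS' : ∀ r a, S.toAddMonoidHom (a * G.tt r) = G.s r * S.toAddMonoidHom a)
    (ha : ∀ a, h.alpha (G.idS S.toAddMonoidHom hS' (G.γ a)) = Ten.tmul _ _ a 1) :
    MixedLR H G.s G.tt G.γ h.γL_mul_sR h.γR_sL_mul := by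
  let E : Ten (rm G.s) (lm G.s) ≃+ H.LTen := AddEquiv.ofBijective h.alpha hα
  have hE : ∀ w, E.symm (h.alpha w) = w := E.symm_apply_apply
  let D : Ten (rm G.s) (lm G.s) →+ G.RTen := G.idSinv hS'
  have hD : ∀ x y, D (Ten.tmul _ _ x y) = Ten.tmul _ _ x (S.symm y) := G.idSinv_tmul hS'
  have hDS : ∀ z, D (G.idS S.toAddMonoidHom hS' z) = z := G.idSinv_idS hS'
  let δ : H.LTen →+ G.RTen := D.comp E.symm.toAddMonoidHom
  have hδα : ∀ w, δ (h.alpha w) = D w := fun w => congrArg D (hE w)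
  have hδ : ∀ a, δ (Ten.tmul _ _ a 1) = G.γ a := fun a => by rw [← ha, hδα, hDS]
  -- `δ` commutes with left multiplication by `s(l)` on the first factor.
  have hδs : ∀ l z, δ (Ten.actL (lm H.tt) (lm H.s) (lm H.s) H.lm_s_t l z) =
      Ten.actL (rm G.s) (rm G.tt) (lm H.s) (lm_rm _ _) l (δ z) := by
    intro l z
    obtain ⟨w, rfl⟩ := hα.2 z
    induction w using Ten.ind with
    | tmul x y =>
      have e : ∀ z : H.LTen, Ten.actL (lm H.tt) (lm H.s) (lm H.s) H.lm_s_t l (H.mulR 1 y z) =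
          H.mulR 1 y (Ten.actL (lm H.tt) (lm H.s) (lm H.s) H.lm_s_t l z) := by
        intro z
        induction z using Ten.ind with
        | tmul u v =>
          rw [H.mulR_tmul, Ten.actL_tmul, Ten.actL_tmul, H.mulR_tmul, lm_apply, lm_apply,
            mul_assoc]
        | add z z₁ hz hz₁ => simp only [map_add, hz, hz₁]
      rw [h.alpha_tmul, e, ← H.γ_s, ← h.alpha_tmul, ← h.alpha_tmul, hδα, hδα, hD, hD,
        Ten.actL_tmul, lm_apply]
    | add w w₁ hw hw₁ => simp only [map_add, hw, hw₁]
  let N : A → H.LTen →+ Ten (lm H.tt) (Ten.actL (rm G.s) (rm G.tt) (lm H.s) (lm_rm H.s G.s)) :=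
    fun v => Ten.mapR (δ.comp (Ten.mkFlip _ _ v)) (fun l y =>
      (congrArg δ (Ten.actL_tmul (lm H.tt) (lm H.s) (lm H.s) H.lm_s_t l y v)).symm.trans (hδs l _))
  have hN : ∀ v x y, N v (Ten.tmul _ _ x y) = Ten.tmul _ _ x (δ (Ten.tmul _ _ y v)) :=
    fun v x y => Ten.mapR_tmul _ _ x y
  let Ψ : H.LTen →+ Ten (lm H.tt) (Ten.actL (rm G.s) (rm G.tt) (lm H.s) (lm_rm H.s G.s)) :=
    Ten.lift (fun u v => N v (H.γ u)) (fun u u₁ v => by rw [map_add, map_add])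
      (fun u v v₁ => by
        generalize H.γ u = z
        induction z using Ten.ind with
        | tmul x y => rw [hN, hN, hN, Ten.tmul_add, map_add, Ten.tmul_add]
        | add z z₁ hz hz₁ => rw [map_add, map_add, map_add, hz, hz₁]; abel)
      (fun l u v => by
        rw [lm_apply, lm_apply, H.γ_t]
        generalize H.γ u = z
        induction z using Ten.ind with
        | tmul x y => rw [Ten.actR_tmul, hN, hN, Ten.balanced, lm_apply]
        | add z z₁ hz hz₁ => rw [map_add, map_add, map_add, hz, hz₁])
  have hΨ : ∀ u v, Ψ (Ten.tmul _ _ u v) = N v (H.γ u) := Ten.lift_tmul _ _ _ _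
  have key : ∀ z, Ten.assoc (rm_lm G.s H.s) (Ten.mapL H.γ h.γL_mul_sR (δ z)) = Ψ z := by
    intro z
    obtain ⟨w, rfl⟩ := hα.2 z
    induction w using Ten.ind with
    | tmul x y =>
      have e := H.coassoc_eval (k := fun v => N (v * y))
        (m := fun u => (Ten.mk _ _ u).comp (δ.comp (H.mulR 1 y)))
        (g₁ := Ψ.comp (H.mulR 1 y)) (g₂ := Ten.append (rm_lm G.s H.s) (S.symm y))
        (fun u v t => by
          simp only [AddMonoidHom.comp_apply]
          rw [hN, Ten.mk_apply, H.mulR_tmul, mul_one])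
        (fun u v => by
          simp only [AddMonoidHom.comp_apply]
          rw [H.mulR_tmul, mul_one, hΨ])
        (fun u v => by
          simp only [AddMonoidHom.comp_apply]
          rw [Ten.append_tmul, Ten.mk_apply, ← h.alpha_tmul, hδα, hD]) x
      rw [hδα, hD, h.alpha_tmul]
      exact e.symm
    | add w w₁ hw hw₁ => rw [map_add, map_add, map_add, map_add, map_add, hw, hw₁]
  intro a
  rw [← hδ, key, hΨ]
  generalize H.γ a = z
  induction z using Ten.ind with
  | tmul x y =>
    rw [hN, hδ]
    exact (Ten.mapR_tmul _ _ x y).symm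
  | add z z₁ hz hz₁ => rw [map_add, map_add, hz, hz₁]

/-- The mirror image of `SameBase.mixedLR_of_alpha`. -/
theorem SameBase.mixedRL_of_beta (h : SameBase H G) (hβ : Function.Bijective h.beta)
    {T : A ≃+ A} (hT' : ∀ r a, T.toAddMonoidHom (a * G.s r) = G.tt r * T.toAddMonoidHom a)
    (hb : ∀ a, h.beta (G.idT T.toAddMonoidHom hT' (G.γ a)) = Ten.tmul _ _ 1 a) :
    MixedRL H G.s G.tt G.γ h.γL_mul_tR h.γR_tL_mul := by
  let E : Ten (lm G.tt) (rm G.tt) ≃+ H.LTen := AddEquiv.ofBijective h.beta hβ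
  have hE : ∀ w, E.symm (h.beta w) = w := E.symm_apply_apply
  let D : Ten (lm G.tt) (rm G.tt) →+ G.RTen := Ten.mapL T.symm.toAddMonoidHom (fun r y => by
    show T.symm (G.tt r * y) = T.symm y * G.s r
    rw [AddEquiv.symm_apply_eq]
    exact ((hT' r (T.symm y)).trans (congrArg (G.tt r * ·) (T.apply_symm_apply y))).symm)
  have hD : ∀ x y, D (Ten.tmul _ _ x y) = Ten.tmul _ _ (T.symm x) y := fun x y =>
    Ten.mapL_tmul _ _ x y
  have hDT : ∀ z, D (G.idT T.toAddMonoidHom hT' z) = z := by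
    intro z
    induction z using Ten.ind with
    | tmul x y =>
      rw [G.idT_tmul, hD]
      exact congrArg (Ten.tmul _ _ · y) (T.symm_apply_apply x)
    | add z z₁ hz hz₁ => rw [map_add, map_add, hz, hz₁]
  let δ : H.LTen →+ G.RTen := D.comp E.symm.toAddMonoidHom
  have hδβ : ∀ w, δ (h.beta w) = D w := fun w => congrArg D (hE w)
  have hδ : ∀ a, δ (Ten.tmul _ _ 1 a) = G.γ a := fun a => by rw [← hb, hδβ, hDT]
  -- `δ` commutes with left multiplication by `t(l)` on the second factor.
  have hδt : ∀ l z, δ (Ten.actR (lm H.tt) (lm H.s) (lm H.tt)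
      (fun j i n => (H.lm_s_t i j n).symm) l z) =
      Ten.actR (rm G.s) (rm G.tt) (lm H.tt) (lm_rm _ _) l (δ z) := by
    intro l z
    obtain ⟨w, rfl⟩ := hβ.2 z
    induction w using Ten.ind with
    | tmul x y =>
      have e : ∀ z : H.LTen, Ten.actR (lm H.tt) (lm H.s) (lm H.tt)
          (fun j i n => (H.lm_s_t i j n).symm) l (H.mulR x 1 z) = H.mulR x 1
          (Ten.actR (lm H.tt) (lm H.s) (lm H.tt) (fun j i n => (H.lm_s_t i j n).symm) l z) := by
        intro z
        induction z using Ten.ind with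
        | tmul u v =>
          rw [H.mulR_tmul, Ten.actR_tmul, Ten.actR_tmul, H.mulR_tmul, lm_apply, lm_apply,
            mul_assoc]
        | add z z₁ hz hz₁ => simp only [map_add, hz, hz₁]
      rw [h.beta_tmul, e, ← H.γ_t, ← h.beta_tmul, ← h.beta_tmul, hδβ, hδβ, hD, hD,
        Ten.actR_tmul, lm_apply]
    | add w w₁ hw hw₁ => simp only [map_add, hw, hw₁]
  let N : A → H.LTen →+ Ten (rm G.s) (Ten.actL (lm H.tt) (lm H.s) (rm G.tt) (rm_lm G.tt H.tt)) :=
    fun u => Ten.lift (fun x y => Ten.append (lm_rm H.tt G.tt) y (δ (Ten.tmul _ _ u x)))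
      (fun x x₁ y => by rw [Ten.tmul_add, map_add, map_add])
      (fun x y y₁ => Ten.append_add _ y y₁ _)
      (fun l x y => by
        have e := hδt l (Ten.tmul _ _ u x)
        rw [Ten.actR_tmul] at e
        rw [e, Ten.append_act])
  have hN : ∀ u x y, N u (Ten.tmul _ _ x y) =
      Ten.append (lm_rm H.tt G.tt) y (δ (Ten.tmul _ _ u x)) := fun u => Ten.lift_tmul _ _ _ _
  let Ψ : H.LTen →+ Ten (rm G.s) (Ten.actL (lm H.tt) (lm H.s) (rm G.tt) (rm_lm G.tt H.tt)) :=
    Ten.lift (fun u v => N u (H.γ v))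
      (fun u u₁ v => by
        generalize H.γ v = z
        induction z using Ten.ind with
        | tmul x y => rw [hN, hN, hN, Ten.add_tmul, map_add, map_add]
        | add z z₁ hz hz₁ => rw [map_add, map_add, map_add, hz, hz₁]; abel)
      (fun u v v₁ => by rw [map_add, map_add])
      (fun l u v => by
        rw [lm_apply, lm_apply, H.γ_s]
        generalize H.γ v = z
        induction z using Ten.ind with
        | tmul x y =>
          have e := Ten.balanced (lm H.tt) (lm H.s) l u x
          rw [lm_apply] at e
          rw [Ten.actL_tmul, hN, hN, e]
        | add z z₁ hz hz₁ => rw [map_add, map_add, map_add, hz, hz₁])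
  have hΨ : ∀ u v, Ψ (Ten.tmul _ _ u v) = N u (H.γ v) := Ten.lift_tmul _ _ _ _
  have key : ∀ z, Ten.mapR H.γ h.γL_mul_tR (δ z) = Ψ z := by
    intro z
    obtain ⟨w, rfl⟩ := hβ.2 z
    induction w using Ten.ind with
    | tmul x y =>
      have e := H.coassoc_eval
        (k := fun z => (Ten.append (lm_rm H.tt G.tt) z).comp (δ.comp (H.mulR x 1)))
        (m := fun u => N (u * x)) (g₁ := Ten.mk _ _ (T.symm x)) (g₂ := Ψ.comp (H.mulR x 1))
        (fun u v t => by
          simp only [AddMonoidHom.comp_apply]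
          rw [hN, H.mulR_tmul, mul_one])
        (fun u v => by
          simp only [AddMonoidHom.comp_apply]
          rw [Ten.mk_apply, ← h.beta_tmul, hδβ, hD, Ten.append_tmul])
        (fun u v => by
          simp only [AddMonoidHom.comp_apply]
          rw [H.mulR_tmul, mul_one, hΨ]) y
      rw [hδβ, hD, h.beta_tmul]
      exact e
    | add w w₁ hw hw₁ => rw [map_add, map_add, map_add, map_add, hw, hw₁]
  intro a
  rw [← hδ, key, hΨ]
  generalize H.γ a = z
  induction z using Ten.ind with
  | tmul x y =>
    rw [hN, hδ]
    rfl
  | add z z₁ hz hz₁ => rw [map_add, map_add, map_add, hz, hz₁]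

end MixedFromGalois

section SymmetricAndGalois

variable {A L R : Type*} [Ring A] [Ring L] [Ring R] {H : LeftBialgebroid A L}
  {G : RightBialgebroid A R}

theorem LeftBialgebroid.convT_symm (S : A ≃+ A) (anti : ∀ a b, S (a * b) = S b * S a)
    (hS : ∀ l a, S (H.tt l * a) = S a * H.s l)
    (hT : ∀ l a, S.symm (H.s l * a) = S.symm a * H.tt l) (z : H.LTen) :
    S (H.convT S.symm.toAddMonoidHom hT z) = H.convS S.toAddMonoidHom hS z := by
  induction z using Ten.ind with
  | tmul x y =>
    refine (congrArg S (H.convT_tmul (T := S.symm.toAddMonoidHom) hT x y)).trans ?_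
    refine ((anti _ _).trans (congrArg (S x * ·) (S.apply_symm_apply y))).trans ?_
    exact (H.convS_tmul (S := S.toAddMonoidHom) hS x y).symm
  | add z z₁ hz hz₁ => rw [map_add, map_add, map_add, hz, hz₁]

theorem RightBialgebroid.convT_symm (S : A ≃+ A) (anti : ∀ a b, S (a * b) = S b * S a)
    (hS : ∀ r a, S (a * G.tt r) = G.s r * S a)
    (hT : ∀ r a, S.symm (a * G.s r) = G.tt r * S.symm a) (z : G.RTen) :
    S (G.convT S.symm.toAddMonoidHom hT z) = G.convS S.toAddMonoidHom hS z := by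
  induction z using Ten.ind with
  | tmul x y =>
    refine (congrArg S (G.convT_tmul (T := S.symm.toAddMonoidHom) hT x y)).trans ?_
    refine ((anti _ _).trans (congrArg (· * S y) (S.apply_symm_apply x))).trans ?_
    exact (G.convS_tmul (S := S.toAddMonoidHom) hS x y).symm
  | add z z₁ hz hz₁ => rw [map_add, map_add, map_add, hz, hz₁]

/-- The symmetric form implies the Hopf algebroid axioms. -/
theorem IsSymmetricForm.isHopfAlgebroid {S : A ≃+ A} (hS : IsSymmetricForm H G S) :
    IsHopfAlgebroid H S := by
  have h := hS.toSameBase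
  have hS₁ : ∀ l a, S (H.tt l * a) = S a * H.s l := tL_of_bimodule hS.S_tL
  have hS₂ : ∀ r a, S (a * G.tt r) = G.s r * S a := tR_of_bimodule hS.S_tR
  have hc₁ : ∀ a, H.convS S.toAddMonoidHom hS₁ (H.γ a) = G.s (G.π a) := hS.S_mul
  have hc₂ : ∀ a, G.convS S.toAddMonoidHom hS₂ (G.γ a) = H.s (H.π a) := hS.mul_S
  have ha := h.alpha_idS hS.mixed_LR hS₂ hc₂
  have hα : Function.Surjective h.alpha := by
    intro z
    induction z using Ten.ind with
    | tmul x y =>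
      refine ⟨Ten.mulSnd _ _ y (G.idS S.toAddMonoidHom hS₂ (G.γ x)), ?_⟩
      rw [h.alpha_mulSnd, ha, H.mulR_tmul, mul_one, one_mul]
    | add z z₁ hz hz₁ =>
      obtain ⟨w, rfl⟩ := hz
      obtain ⟨w₁, rfl⟩ := hz₁
      exact ⟨w + w₁, map_add _ _ _⟩
  have anti : ∀ a b, S (a * b) = S b * S a := h.antipode_mul hα hS₁ hc₁
  have S_one : S 1 = 1 := H.conv_S_one hS₁ hc₁
  have S_t : ∀ l, S (H.tt l) = H.s l := fun l => by
    rw [← mul_one (H.tt l), hS₁, S_one, one_mul]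
  have S_tR : ∀ r, S (G.tt r) = G.s r := h.S_tR hS₁ hc₁
  have hT₁ := Sinv_s_mul H S anti S_t
  have hT₂ : ∀ r a, S.symm (a * G.s r) = G.tt r * S.symm a := fun r a => by
    rw [anti_symm S anti, ← S_tR, S.symm_apply_apply]
  have hd : ∀ a, G.convT S.symm.toAddMonoidHom hT₂ (G.γ a) = H.tt (H.π a) := fun a => by
    apply S.injective
    rw [G.convT_symm S anti hS₂ hT₂, hc₂, S_t]
  have hc : ∀ a, H.convT S.symm.toAddMonoidHom hT₁ (H.γ a) = G.tt (G.π a) := fun a => by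
    apply S.injective
    rw [H.convT_symm S anti hS₁ hT₁, hc₁, S_tR]
  exact
    { anti := anti
      S_t := S_t
      ax_Sinv := h.axiomMapSinv_γ hS.mixed_RL hT₁ hT₂ hc (h.beta_idT hS.mixed_RL hT₂ hd)
      ax_S := h.axiomMapS_γ hS.mixed_LR hS₁ hS₂ hc₁ ha }

theorem IsSymmetricForm.isGaloisForm {S : A ≃+ A} (hS : IsSymmetricForm H G S) :
    IsGaloisForm H G :=
  { hS.toIsCompatible with
    alpha_bij := hS.isHopfAlgebroid.alpha_bijective hS.toSameBase
    beta_bij := hS.isHopfAlgebroid.beta_bijective hS.toSameBase }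

end SymmetricAndGalois

/-! ### The antipode of the Galois form -/

section AntipodeFromGalois

variable {A L R : Type*} [Ring A] [Ring L] [Ring R] {H : LeftBialgebroid A L}
  {G : RightBialgebroid A R}

/-- If `α` is bijective, then the sum `S(a)` of the elements `s_R(π_R(x)) y`, where
`α⁻¹(a ⊗ 1)` is the sum of the elements `x ⊗ y`, satisfies the antipode identity
`S(a₁) a₂ = s_R(π_R(a))`. -/
theorem SameBase.exists_antipode (h : SameBase H G) (hα : Function.Bijective h.alpha) :
    ∃ (S : A →+ A) (hS : ∀ l a, S (H.tt l * a) = S a * H.s l),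
      ∀ a, H.convS S hS (H.γ a) = G.s (G.π a) := by
  let E : Ten (rm G.s) (lm G.s) ≃+ H.LTen := AddEquiv.ofBijective h.alpha hα
  have hE : ∀ w, E.symm (h.alpha w) = w := E.symm_apply_apply
  let ν : Ten (rm G.s) (lm G.s) →+ A :=
    Ten.lift (fun x y => G.s (G.π x) * y)
      (fun x x₁ y => by rw [map_add, map_add, add_mul]) (fun x y y₁ => mul_add _ _ _)
      (fun r x y => by rw [rm_apply, lm_apply, G.π_s, map_mul, mul_assoc])
  have hν : ∀ x y, ν (Ten.tmul _ _ x y) = G.s (G.π x) * y := Ten.lift_tmul _ _ _ _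
  let κ : H.LTen →+ A := ν.comp E.symm.toAddMonoidHom
  have hκα : ∀ w, κ (h.alpha w) = ν w := fun w => congrArg ν (hE w)
  have hκ : ∀ v z, κ (H.mulR 1 v z) = κ z * v := by
    intro v z
    obtain ⟨w, rfl⟩ := hα.2 z
    rw [← h.alpha_mulSnd, hκα, hκα]
    induction w using Ten.ind with
    | tmul x y => rw [Ten.mulSnd_tmul, hν, hν, mul_assoc]
    | add w w₁ hw hw₁ => rw [map_add, map_add, map_add, add_mul, hw, hw₁]
  let S : A →+ A := κ.comp (Ten.mkFlip _ _ 1)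
  have hSκ : ∀ x y, κ (Ten.tmul _ _ x y) = S x * y := fun x y => by
    have e := hκ y (Ten.tmul _ _ x 1)
    rw [H.mulR_tmul, mul_one, one_mul] at e
    exact e
  have hS : ∀ l a, S (H.tt l * a) = S a * H.s l := fun l a => by
    have e := Ten.balanced (lm H.tt) (lm H.s) l a 1
    rw [lm_apply, lm_apply, mul_one] at e
    rw [← hSκ, ← e]
    rfl
  refine ⟨S, hS, fun a => ?_⟩
  have e : ∀ z, H.convS S hS z = κ z := by
    intro z
    induction z using Ten.ind with
    | tmul x y => rw [H.convS_tmul, hSκ]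
    | add z z₁ hz hz₁ => rw [map_add, map_add, hz, hz₁]
  have e₁ := hκα (Ten.tmul _ _ a 1)
  rwa [h.alpha_tmul, H.mulR_one, hν, mul_one, ← e] at e₁

/-- If `β` is bijective, then the sum `T(a)` of the elements `t_R(π_R(y)) x`, where
`β⁻¹(1 ⊗ a)` is the sum of the elements `x ⊗ y`, satisfies the identity
`T(a₂) a₁ = t_R(π_R(a))` of an inverse antipode. -/
theorem SameBase.exists_antipodeInv (h : SameBase H G) (hβ : Function.Bijective h.beta) :
    ∃ (T : A →+ A) (hT : ∀ l a, T (H.s l * a) = T a * H.tt l),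
      ∀ a, H.convT T hT (H.γ a) = G.tt (G.π a) := by
  let E : Ten (lm G.tt) (rm G.tt) ≃+ H.LTen := AddEquiv.ofBijective h.beta hβ
  have hE : ∀ w, E.symm (h.beta w) = w := E.symm_apply_apply
  let ν : Ten (lm G.tt) (rm G.tt) →+ A :=
    Ten.lift (fun x y => G.tt (G.π y) * x)
      (fun x x₁ y => mul_add _ _ _)
      (fun x y y₁ => by rw [map_add, G.tt_add, add_mul])
      (fun r x y => by rw [rm_apply, lm_apply, G.π_t, G.tt_mul, mul_assoc])
  have hν : ∀ x y, ν (Ten.tmul _ _ x y) = G.tt (G.π y) * x := Ten.lift_tmul _ _ _ _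
  let κ : H.LTen →+ A := ν.comp E.symm.toAddMonoidHom
  have hκβ : ∀ w, κ (h.beta w) = ν w := fun w => congrArg ν (hE w)
  have hκ : ∀ v z, κ (H.mulR v 1 z) = κ z * v := by
    intro v z
    obtain ⟨w, rfl⟩ := hβ.2 z
    rw [← h.beta_mulFst, hκβ, hκβ]
    induction w using Ten.ind with
    | tmul x y => rw [Ten.mulFst_tmul, hν, hν, mul_assoc]
    | add w w₁ hw hw₁ => rw [map_add, map_add, map_add, add_mul, hw, hw₁]
  let T : A →+ A := κ.comp (Ten.mk _ _ 1)
  have hTκ : ∀ x y, κ (Ten.tmul _ _ x y) = T y * x := fun x y => by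
    have e := hκ x (Ten.tmul _ _ 1 y)
    rw [H.mulR_tmul, mul_one, one_mul] at e
    exact e
  have hT : ∀ l a, T (H.s l * a) = T a * H.tt l := fun l a => by
    have e := Ten.balanced (lm H.tt) (lm H.s) l 1 a
    rw [lm_apply, lm_apply, mul_one] at e
    rw [← hTκ, e]
    rfl
  refine ⟨T, hT, fun a => ?_⟩
  have e : ∀ z, H.convT T hT z = κ z := by
    intro z
    induction z using Ten.ind with
    | tmul x y => rw [H.convT_tmul, hTκ]
    | add z z₁ hz hz₁ => rw [map_add, map_add, hz, hz₁]
  have e₁ := hκβ (Ten.tmul _ _ 1 a)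
  rwa [h.beta_tmul, H.mulR_one, hν, mul_one, ← e] at e₁

/-- Bijective `α` and `β` provide an antipode and an inverse antipode. Each is anti-multiplicative,
and they are mutually inverse: applying `S` to `T(a₂) a₁ = t_R(π_R(a))` gives
`S(a₁) S(T(a₂)) = s_R(π_R(a))`, so that evaluating `a¹ S(a²₁) S(T(a²₂))` with the two antipode
identities yields `a = S(T(a))`; the other composite is treated in the same way. -/
theorem IsGaloisForm.exists_isSymmetricForm (hG : IsGaloisForm H G) :
    ∃ S : A ≃+ A, IsSymmetricForm H G S := by
  have h := hG.toSameBase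
  obtain ⟨S, hS, hSc⟩ := h.exists_antipode hG.alpha_bij
  obtain ⟨T, hT, hTc⟩ := h.exists_antipodeInv hG.beta_bij
  have S_mul := h.antipode_mul hG.alpha_bij.2 hS hSc
  have T_mul := h.antipodeInv_mul hG.beta_bij.2 hT hTc
  have S_one := H.conv_S_one hS hSc
  have T_one := H.conv_T_one hT hTc
  have S_t : ∀ l, S (H.tt l) = H.s l := fun l => by
    rw [← mul_one (H.tt l), hS, S_one, one_mul]
  have T_s : ∀ l, T (H.s l) = H.tt l := fun l => by
    rw [← mul_one (H.s l), hT, T_one, one_mul]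
  have S_tR := h.S_tR hS hSc
  have T_sR := h.T_sR hT hTc
  have hS' : ∀ r a, S (a * G.tt r) = G.s r * S a := fun r a => by rw [S_mul, S_tR]
  have hT' : ∀ r a, T (a * G.s r) = G.tt r * T a := fun r a => by rw [T_mul, T_sR]
  have hSd := h.mul_S_of_alpha hS'
    (h.alpha_idS_of_surjective hG.mixed_RL hG.alpha_bij.2 hS hS' hSc)
  have hTd := h.mul_T_of_beta hT'
    (h.beta_idT_of_surjective hG.mixed_LR hG.beta_bij.2 hT hT' hTc)
  have hST : ∀ a, S (T a) = a := fun a => by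
    have e := hG.mixed_RL.eval
      (k := fun z => (AddMonoidHom.mulRight (S (T z))).comp (G.convS S hS'))
      (m := fun x => (AddMonoidHom.mulLeft x).comp (S.comp (H.convT T hT)))
      (g₁ := S.comp (T.comp H.epsL)) (g₂ := G.epsR)
      (fun u v z => by
        simp only [AddMonoidHom.comp_apply, AddMonoidHom.coe_mulRight, AddMonoidHom.coe_mulLeft]
        rw [G.convS_tmul, H.convT_tmul, S_mul, mul_assoc])
      (fun u z => by
        simp only [AddMonoidHom.comp_apply, AddMonoidHom.coe_mulRight]
        rw [H.epsL_tmul, hT, S_mul, S_t, hSd])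
      (fun u v => by
        simp only [AddMonoidHom.comp_apply, AddMonoidHom.coe_mulLeft]
        rw [G.epsR_tmul, hTc, S_tR]) a
    rwa [AddMonoidHom.comp_apply, AddMonoidHom.comp_apply, H.epsL_γ, G.epsR_γ] at e
  have hTS : ∀ a, T (S a) = a := fun a => by
    have e := hG.mixed_LR.eval
      (k := fun z => (AddMonoidHom.mulLeft z).comp (T.comp (H.convS S hS)))
      (m := fun x => (AddMonoidHom.mulRight (T (S x))).comp (G.convT T hT'))
      (g₁ := G.epsL) (g₂ := T.comp (S.comp H.epsR))
      (fun u v z => by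
        simp only [AddMonoidHom.comp_apply, AddMonoidHom.coe_mulRight, AddMonoidHom.coe_mulLeft]
        rw [G.convT_tmul, H.convS_tmul, T_mul, mul_assoc])
      (fun u z => by
        simp only [AddMonoidHom.comp_apply, AddMonoidHom.coe_mulLeft]
        rw [G.epsL_tmul, hSc, T_sR])
      (fun u v => by
        simp only [AddMonoidHom.comp_apply, AddMonoidHom.coe_mulRight]
        rw [H.epsR_tmul, hS, T_mul, T_s, hTd]) a
    rw [AddMonoidHom.comp_apply, AddMonoidHom.comp_apply, H.epsR_γ, G.epsL_γ] at e
    exact e.symm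
  let S' : A ≃+ A := AddMonoidHom.toAddEquiv S T
    (AddMonoidHom.ext hTS) (AddMonoidHom.ext hST)
  refine ⟨S', { hG.toIsCompatible with
    S_tL := fun l l₁ a => ?_
    S_tR := fun r r₁ a => ?_
    S_mul := hSc
    mul_S := hSd }⟩
  · show S _ = _ * S a * _
    rw [S_mul, S_mul, S_t, S_t, mul_assoc]
  · show S _ = _ * S a * _
    rw [S_mul, S_mul, S_tR, S_tR, mul_assoc]

end AntipodeFromGalois

/-! ### Transport through an anti-automorphism, and the Lu-style form -/

section Transport

variable {A L R : Type*} [Ring A] [Ring L] [Ring R] {H : LeftBialgebroid A L} {S : A ≃+ A}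

theorem LeftBialgebroid.tt_injective (H : LeftBialgebroid A L) : Function.Injective H.tt :=
  Function.LeftInverse.injective H.π_tgt

theorem LuBase.S_one (h : LuBase H S) : S 1 = 1 := by
  have e := h.S_t 1
  rwa [H.tt_one, map_one H.s] at e

theorem LuBase.theta_add (_h : LuBase H S) (l l₁ : L) :
    theta H S (l + l₁) = theta H S l + theta H S l₁ := by
  simp only [theta, map_add]

theorem LuBase.theta_mul (h : LuBase H S) (l l₁ : L) :
    theta H S (l * l₁) = theta H S l * theta H S l₁ := by
  apply H.tt_injective
  rw [H.tt_mul, ← h.S_s, ← h.S_s, ← h.S_s, map_mul, h.anti]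

theorem LuBase.theta_one (h : LuBase H S) : theta H S 1 = 1 := by
  rw [theta, map_one, h.S_one, H.π_one]

/-- The source and target maps of the right bialgebroid obtained from `H` through the
anti-automorphism `S`: `s_R(μ(l)) = t_L(l)` and `t_R(μ(θ(l))) = s_L(l)`. -/
noncomputable def LuBase.baseMaps (h : LuBase H S) (μ : Lᵐᵒᵖ ≃+* R) : BaseMaps A R where
  s :=
    { toFun := srcElt H μ
      map_one' := by simp [srcElt, H.tt_one]
      map_mul' := fun r r₁ => by
        simp only [srcElt, map_mul, MulOpposite.unop_mul, H.tt_mul]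
      map_zero' := by
        simp only [srcElt, map_zero, MulOpposite.unop_zero]; exact map_zero H.t
      map_add' := fun r r₁ => by
        simp only [srcElt, map_add, MulOpposite.unop_add, H.tt_add] }
  t :=
    { toFun := fun r => h.tgtElt μ r.unop
      map_one' := S.injective (by rw [h.S_tgtElt, h.S_one]; simp [srcElt, H.tt_one])
      map_mul' := fun r r₁ => S.injective (by
        rw [h.anti, h.S_tgtElt, h.S_tgtElt, h.S_tgtElt]
        simp only [srcElt, map_mul, MulOpposite.unop_mul, H.tt_mul])
      map_zero' := S.injective (by
        rw [h.S_tgtElt, map_zero]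
        simp only [srcElt, map_zero, MulOpposite.unop_zero]; exact map_zero H.t)
      map_add' := fun r r₁ => S.injective (by
        rw [map_add, h.S_tgtElt, h.S_tgtElt, h.S_tgtElt]
        simp only [srcElt, map_add, MulOpposite.unop_add, H.tt_add]) }
  comm := fun _ _ => (H.comm _ _).symm

variable (h : LuBase H S) (μ : Lᵐᵒᵖ ≃+* R)

theorem LuBase.baseMaps_s (l : L) : (h.baseMaps μ).s (μ (MulOpposite.op l)) = H.tt l :=
  srcElt_op H μ l

theorem LuBase.baseMaps_t (l : L) :
    (h.baseMaps μ).tt (μ (MulOpposite.op (theta H S l))) = H.s l :=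
  h.tgtElt_op μ l

theorem LuBase.exists_eq_theta (h : LuBase H S) (μ : Lᵐᵒᵖ ≃+* R) (r : R) :
    ∃ l, r = μ (MulOpposite.op (theta H S l)) := by
  obtain ⟨l, hl⟩ := h.theta_bij.2 (MulOpposite.unop (μ.symm r))
  exact ⟨l, by rw [hl, MulOpposite.op_unop, RingEquiv.apply_symm_apply]⟩

/-- The map `x ⊗ y ↦ S(y) ⊗ S(x)`, with values in the tensor product over the transported base
maps. -/
noncomputable def LuBase.twist : H.LTen →+ (h.baseMaps μ).RTen := h.twistL μ

/-- The coproduct `γ_R`, with values in the tensor product over the transported base maps. -/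
noncomputable def LuBase.coprod : A →+ (h.baseMaps μ).RTen := h.gammaR μ

theorem LuBase.twist_tmul (x y : A) :
    h.twist μ (Ten.tmul _ _ x y) = Ten.tmul _ _ (S y) (S x) := h.twistL_tmul μ x y

theorem LuBase.coprod_apply (a : A) : h.coprod μ a = h.twist μ (H.γ (S.symm a)) := rfl

theorem LuBase.coprod_S (a : A) : h.coprod μ (S a) = h.twist μ (H.γ a) := by
  rw [h.coprod_apply, S.symm_apply_apply]

theorem LuBase.twist_mulR (u v : A) (z : H.LTen) :
    h.twist μ (H.mulR u v z) = (h.baseMaps μ).mulL (S v) (S u) (h.twist μ z) := by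
  induction z using Ten.ind with
  | tmul x y =>
    rw [H.mulR_tmul, h.twist_tmul, h.twist_tmul, BaseMaps.mulL_tmul, h.anti, h.anti]
  | add z z₁ hz hz₁ => simp only [map_add, hz, hz₁]

theorem LuBase.coprod_mul_s (r : R) (a : A) : h.coprod μ (a * (h.baseMaps μ).s r) =
    Ten.actR (rm (h.baseMaps μ).s) (rm (h.baseMaps μ).tt) (rm (h.baseMaps μ).s)
      (h.baseMaps μ).rm_s_t r (h.coprod μ a) := by
  obtain ⟨l, rfl⟩ := h.exists_eq_theta μ r
  obtain ⟨a, rfl⟩ := S.surjective a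
  rw [h.baseMaps_s, ← h.S_s, ← h.anti, h.coprod_S, h.coprod_S, H.γ_s]
  generalize H.γ a = z
  induction z using Ten.ind with
  | tmul x y =>
    rw [Ten.actL_tmul, h.twist_tmul, h.twist_tmul, Ten.actR_tmul, lm_apply, rm_apply, h.anti,
      h.baseMaps_s, h.S_s]
  | add z z₁ hz hz₁ => simp only [map_add, hz, hz₁]

theorem LuBase.coprod_mul_t (r : R) (a : A) : h.coprod μ (a * (h.baseMaps μ).tt r) =
    Ten.actL (rm (h.baseMaps μ).s) (rm (h.baseMaps μ).tt) (rm (h.baseMaps μ).tt)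
      (fun j i n => ((h.baseMaps μ).rm_s_t i j n).symm) r (h.coprod μ a) := by
  obtain ⟨l, rfl⟩ := h.exists_eq_theta μ r
  obtain ⟨a, rfl⟩ := S.surjective a
  rw [h.baseMaps_t, ← h.S_t, ← h.anti, h.coprod_S, h.coprod_S, H.γ_t]
  generalize H.γ a = z
  induction z using Ten.ind with
  | tmul x y =>
    rw [Ten.actR_tmul, h.twist_tmul, h.twist_tmul, Ten.actL_tmul, lm_apply, rm_apply, h.anti,
      h.baseMaps_t, h.S_t]
  | add z z₁ hz hz₁ => simp only [map_add, hz, hz₁]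

/-- The counit `a ↦ μ(θ(π_L(S⁻¹(a))))` belonging to `γ_R`. -/
noncomputable def LuBase.counit : A →+ R :=
  AddMonoidHom.mk' (fun a => μ (MulOpposite.op (theta H S (H.π (S.symm a)))))
    (fun a b => by rw [map_add, map_add, h.theta_add, MulOpposite.op_add, map_add])

theorem LuBase.counit_S (a : A) :
    h.counit μ (S a) = μ (MulOpposite.op (theta H S (H.π a))) := by
  show μ (MulOpposite.op (theta H S (H.π (S.symm (S a))))) = _
  rw [S.symm_apply_apply]

theorem LuBase.coprod_coassoc (a : A) :
    Ten.assoc (h.baseMaps μ).rm_s_t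
      (Ten.mapL (h.coprod μ) (h.coprod_mul_s μ) (h.coprod μ a)) =
    Ten.mapR (h.coprod μ) (h.coprod_mul_t μ) (h.coprod μ a) := by
  obtain ⟨a, rfl⟩ := S.surjective a
  rw [h.coprod_S]
  have e := H.coassoc_eval
    (k := fun z => (Ten.mk _ _ (S z)).comp (h.twist μ))
    (m := fun x => (Ten.assoc (κ := rm (h.baseMaps μ).tt) (h.baseMaps μ).rm_s_t).comp
      ((Ten.mkFlip _ _ (S x)).comp (h.twist μ)))
    (g₁ := (Ten.mapR (h.coprod μ) (h.coprod_mul_t μ)).comp (h.twist μ))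
    (g₂ := (Ten.assoc (h.baseMaps μ).rm_s_t).comp
      ((Ten.mapL (h.coprod μ) (h.coprod_mul_s μ)).comp (h.twist μ)))
    (fun x y z => by
      simp only [AddMonoidHom.comp_apply, Ten.mk_apply, Ten.mkFlip_apply]
      rw [h.twist_tmul, h.twist_tmul, Ten.assoc_tmul])
    (fun u z => by
      simp only [AddMonoidHom.comp_apply, Ten.mk_apply]
      rw [h.twist_tmul]
      refine (Ten.mapR_tmul _ (h.coprod_mul_t μ) _ _).trans ?_
      rw [h.coprod_S])
    (fun x w => by
      simp only [AddMonoidHom.comp_apply, Ten.mkFlip_apply]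
      rw [h.twist_tmul]
      refine congrArg _ ((Ten.mapL_tmul _ (h.coprod_mul_s μ) _ _).trans ?_)
      rw [h.coprod_S]) a
  exact e.symm

theorem LuBase.coprod_takeuchi (a : A) : (h.baseMaps μ).IsTakeuchiR (h.coprod μ a) := by
  intro r
  obtain ⟨l, rfl⟩ := h.exists_eq_theta μ r
  have e := congrArg (h.twist μ) (H.takeuchi (S.symm a) l)
  rw [h.twist_mulR, h.twist_mulR, h.S_one, h.S_t, h.S_s] at e
  rw [h.baseMaps_s, h.baseMaps_t, h.coprod_apply, e]

theorem BaseMaps.prodR_tmul {K : Type*} [Ring K] (B : BaseMaps A K) (z : B.RTen)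
    (hz : B.IsTakeuchiR z) (u v : A) : B.prodR z hz (Ten.tmul _ _ u v) = B.mulL u v z :=
  Ten.lift_tmul _ _ _ _ u v

theorem LuBase.coprod_mul (a b : A) : h.coprod μ (a * b) =
    (h.baseMaps μ).prodR (h.coprod μ b) (h.coprod_takeuchi μ b) (h.coprod μ a) := by
  have e : ∀ w : H.LTen, h.twist μ (H.prodL (H.γ (S.symm b)) (H.takeuchi _) w) =
      (h.baseMaps μ).prodR (h.coprod μ b) (h.coprod_takeuchi μ b) (h.twist μ w) := by
    intro w
    induction w using Ten.ind with
    | tmul u v =>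
      rw [H.prodL_tmul, h.twist_mulR, h.twist_tmul, BaseMaps.prodR_tmul, ← h.coprod_apply]
    | add w w₁ hw hw₁ => simp only [map_add, hw, hw₁]
  rw [h.coprod_apply μ (a * b), anti_symm S h.anti, H.γ_mul, e, ← h.coprod_apply]

/-- The right bialgebroid over `R` obtained from `H` through the anti-automorphism `S` of `A`. -/
noncomputable def LuBase.rightBialgebroid : RightBialgebroid A R where
  toBaseMaps := h.baseMaps μ
  γ := h.coprod μ
  π := h.counit μ
  γ_s := h.coprod_mul_s μ
  γ_t := h.coprod_mul_t μ
  π_s := fun r a => by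
    obtain ⟨l, rfl⟩ := h.exists_eq_theta μ r
    obtain ⟨a, rfl⟩ := S.surjective a
    rw [h.baseMaps_s, ← h.S_s, ← h.anti, h.counit_S, h.counit_S, H.π_s, h.theta_mul,
      MulOpposite.op_mul, map_mul]
  π_t := fun r a => by
    obtain ⟨l, rfl⟩ := h.exists_eq_theta μ r
    obtain ⟨a, rfl⟩ := S.surjective a
    rw [h.baseMaps_t, ← h.S_t, ← h.anti, h.counit_S, h.counit_S, H.π_t, h.theta_mul,
      MulOpposite.op_mul, map_mul]
  coassoc := h.coprod_coassoc μ
  counit_left := fun a => by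
    obtain ⟨a, rfl⟩ := S.surjective a
    rw [h.coprod_S]
    refine Eq.trans ?_ (congrArg S (H.epsR_γ a))
    generalize H.γ a = z
    induction z using Ten.ind with
    | tmul x y =>
      rw [h.twist_tmul, H.epsR_tmul, h.anti, h.S_t]
      refine (Ten.lift_tmul _ _ _ _ (S y) (S x)).trans ?_
      rw [h.counit_S, h.baseMaps_t]
    | add z z₁ hz hz₁ => rw [map_add, map_add, map_add, map_add, hz, hz₁]
  counit_right := fun a => by
    obtain ⟨a, rfl⟩ := S.surjective a
    rw [h.coprod_S]
    refine Eq.trans ?_ (congrArg S (H.epsL_γ a))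
    generalize H.γ a = z
    induction z using Ten.ind with
    | tmul x y =>
      rw [h.twist_tmul, H.epsL_tmul, h.anti, h.S_s]
      refine (Ten.lift_tmul _ _ _ _ (S y) (S x)).trans ?_
      rw [h.counit_S, h.baseMaps_s]
    | add z z₁ hz hz₁ => rw [map_add, map_add, map_add, map_add, hz, hz₁]
  takeuchi := h.coprod_takeuchi μ
  γ_one := by
    have e := h.coprod_S μ 1
    rwa [H.γ_one, h.twist_tmul, h.S_one] at e
  γ_mul := h.coprod_mul μ
  π_one := by
    have e := h.counit_S μ 1
    rwa [h.S_one, H.π_one, h.theta_one, MulOpposite.op_one, map_one μ] at e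
  π_mul_s := fun a b => by
    obtain ⟨a, rfl⟩ := S.surjective a
    obtain ⟨b, rfl⟩ := S.surjective b
    rw [h.counit_S, h.baseMaps_s, ← h.S_s, ← h.anti, ← h.anti, h.counit_S, h.counit_S, H.π_mul_s]
  π_mul_t := fun a b => by
    obtain ⟨a, rfl⟩ := S.surjective a
    obtain ⟨b, rfl⟩ := S.surjective b
    rw [h.counit_S, h.baseMaps_t, ← h.S_t, ← h.anti, ← h.anti, h.counit_S, h.counit_S, H.π_mul_t]

theorem LuBase.sameBase : SameBase H (h.rightBialgebroid μ) where
  s_eq := by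
    ext a
    constructor
    · rintro ⟨l, rfl⟩
      exact ⟨MulOpposite.op (μ (MulOpposite.op (theta H S l))), h.baseMaps_t μ l⟩
    · rintro ⟨r, rfl⟩
      exact ⟨_, rfl⟩
  t_eq := by
    ext a
    constructor
    · rintro ⟨l, rfl⟩
      exact ⟨μ l, h.baseMaps_s μ l.unop⟩
    · rintro ⟨r, rfl⟩
      exact ⟨_, rfl⟩

end Transport

section LuForm

variable {A L R : Type*} [Ring A] [Ring L] [Ring R] {H : LeftBialgebroid A L} {S : A ≃+ A}

theorem LuBase.S_tgt (h : LuBase H S) (μ : Lᵐᵒᵖ ≃+* R) (r : R) :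
    S ((h.rightBialgebroid μ).tt r) = (h.rightBialgebroid μ).s r := h.S_tgtElt μ r

theorem LuBase.S_mul_tR (h : LuBase H S) (μ : Lᵐᵒᵖ ≃+* R) (r : R) (a : A) :
    S (a * (h.rightBialgebroid μ).tt r) = (h.rightBialgebroid μ).s r * S a := by
  rw [h.anti, h.S_tgt]

theorem LuBase.rightBialgebroid_s_π (h : LuBase H S) (μ : Lᵐᵒᵖ ≃+* R) (a : A) :
    (h.rightBialgebroid μ).s ((h.rightBialgebroid μ).π a) = S (H.s (H.π (S.symm a))) := by
  obtain ⟨a, rfl⟩ := S.surjective a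
  refine (congrArg (h.baseMaps μ).s (h.counit_S μ a)).trans ?_
  rw [h.baseMaps_s, S.symm_apply_apply, h.S_s]

/-- `a¹ S(a²) = s_L(π_L(a))` for `γ_R(a) = a¹ ⊗ a²`: with `a = S(c)`, the left-hand side is
`S(S(c₁) c₂) = S(t_L(π_L(S(c))))`. -/
theorem LuBase.mul_S (h : LuBase H S) (μ : Lᵐᵒᵖ ≃+* R) (a : A) :
    (h.rightBialgebroid μ).convS S.toAddMonoidHom (h.S_mul_tR μ) (h.coprod μ a) =
      H.s (H.π a) := by
  obtain ⟨a, rfl⟩ := S.surjective a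
  rw [h.coprod_S, ← h.S_t, ← h.S_mul]
  refine Ten.hom_ext
    (f := ((h.rightBialgebroid μ).convS S.toAddMonoidHom (h.S_mul_tR μ)).comp (h.twist μ))
    (g := S.toAddMonoidHom.comp (antipodeMulL H S (S_t_mul H S h.anti h.S_t)))
    (fun x y => ?_) (H.γ a)
  refine (congrArg ((h.rightBialgebroid μ).convS S.toAddMonoidHom (h.S_mul_tR μ))
    (h.twist_tmul μ x y)).trans ?_
  refine ((h.rightBialgebroid μ).convS_tmul (S := S.toAddMonoidHom) (h.S_mul_tR μ) _ _).trans ?_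
  exact (h.anti (S x) y).symm

/-- The first antipode identity for the transported right bialgebroid, given the identity
`S⁻¹(a₂) a₁ = s_L(π_L(S⁻¹(a)))`. -/
theorem LuBase.S_mul_of_convT (h : LuBase H S) (μ : Lᵐᵒᵖ ≃+* R)
    (hT : ∀ a, H.convT S.symm.toAddMonoidHom (Sinv_s_mul H S h.anti h.S_t) (H.γ a) =
      H.s (H.π (S.symm a))) (a : A) :
    H.convS S.toAddMonoidHom (S_t_mul H S h.anti h.S_t) (H.γ a) =
      (h.rightBialgebroid μ).s ((h.rightBialgebroid μ).π a) := by
  rw [h.rightBialgebroid_s_π, ← hT]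
  exact (H.convT_symm S h.anti _ _ _).symm

/-- The Lu-style form implies the symmetric form. The equality of the two expressions for `γ_R`
turns `a¹ S(a²) = s_L(π_L(a))` into `S⁻¹(d₂) d₁ = s_L(π_L(S⁻¹(d)))` for `d = S(a)`. -/
theorem IsLuForm.isSymmetricForm {μ : Lᵐᵒᵖ ≃+* R} (hS : IsLuForm H S μ) :
    IsSymmetricForm H (hS.toLuBase.rightBialgebroid μ) S := by
  have h := hS.toLuBase
  have hT : ∀ a, H.convT S.symm.toAddMonoidHom (Sinv_s_mul H S h.anti h.S_t) (H.γ a) =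
      H.s (H.π (S.symm a)) := by
    intro a
    obtain ⟨a, rfl⟩ := S.surjective a
    rw [S.symm_apply_apply, ← h.mul_S μ a]
    have e : h.coprod μ a = (h.twistR μ).symm (H.γ (S a)) := hS.gammaR_eq a
    rw [e]
    generalize H.γ (S a) = z
    induction z using Ten.ind with
    | tmul x y =>
      refine (H.convT_tmul (T := S.symm.toAddMonoidHom) _ x y).trans ?_
      refine Eq.trans ?_ ((h.rightBialgebroid μ).convS_tmul (S := S.toAddMonoidHom)
        (h.S_mul_tR μ) (S.symm y) (S.symm x)).symm
      exact congrArg (S.symm y * ·) (S.apply_symm_apply x).symm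
    | add z z₁ hz hz₁ =>
      rw [map_add, hz, hz₁]
      refine (map_add _ _ _).symm.trans (congrArg _ ?_)
      exact (map_add (h.twistR μ).symm z z₁).symm
  exact
    { toSameBase := h.sameBase μ
      base_iso := ⟨μ.symm⟩
      mixed_LR := hS.mixed_LR
      mixed_RL := hS.mixed_RL
      S_tL := fun l l₁ a => by rw [h.anti, h.anti, h.S_t, h.S_t, mul_assoc]
      S_tR := fun r r₁ a => by rw [h.anti, h.anti, h.S_tgt, h.S_tgt, mul_assoc]
      S_mul := h.S_mul_of_convT μ hT
      mul_S := h.mul_S μ }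

end LuForm

/-! ### From Hopf algebroids to the Lu-style form -/

section HopfToLu

variable {A L R : Type*} [Ring A] [Ring L] [Ring R] {H : LeftBialgebroid A L} {S : A ≃+ A}

theorem antipodeMulL_tmul (hS : ∀ l a, S (H.tt l * a) = S a * H.s l) (x y : A) :
    antipodeMulL H S hS (Ten.tmul _ _ x y) = S x * y := Ten.lift_tmul _ _ _ _ x y

/-- The counit applied to the second factor of `S(a₁)₁ a₂ ⊗ S(a₁)₂ = 1 ⊗ S(a)`. -/
theorem IsHopfAlgebroid.S_mul (hS : IsHopfAlgebroid H S) (a : A) :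
    antipodeMulL H S (S_t_mul H S hS.anti hS.S_t) (H.γ a) = H.tt (H.π (S a)) := by
  have e : ∀ z, H.epsR (axiomMapS H S (S_t_mul H S hS.anti hS.S_t) z) =
      antipodeMulL H S (S_t_mul H S hS.anti hS.S_t) z := by
    intro z
    induction z using Ten.ind with
    | tmul x y =>
      rw [axiomMapS_tmul, H.epsR_mulR, H.epsR_γ, antipodeMulL_tmul]
    | add z z₁ hz hz₁ => rw [map_add, map_add, map_add, hz, hz₁]
  rw [← e, hS.ax_S, H.epsR_tmul, mul_one]

/-- The counit applied to the first factor of `S⁻¹(a₂)₁ ⊗ S⁻¹(a₂)₂ a₁ = S⁻¹(a) ⊗ 1`. -/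
theorem IsHopfAlgebroid.Sinv_mul (hS : IsHopfAlgebroid H S) (a : A) :
    H.convT S.symm.toAddMonoidHom (Sinv_s_mul H S hS.anti hS.S_t) (H.γ a) =
      H.s (H.π (S.symm a)) := by
  have e := Ten.hom_ext
    (f := H.epsL.comp (axiomMapSinv H S (Sinv_s_mul H S hS.anti hS.S_t)))
    (g := H.convT S.symm.toAddMonoidHom (Sinv_s_mul H S hS.anti hS.S_t))
    (fun x y => by
      rw [AddMonoidHom.comp_apply, axiomMapSinv_tmul, H.epsL_mulR, H.epsL_γ]
      exact (H.convT_tmul (T := S.symm.toAddMonoidHom) _ x y).symm) (H.γ a)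
  rw [← e, AddMonoidHom.comp_apply, hS.ax_Sinv, H.epsL_tmul, mul_one]

/-- The map `π_L ∘ S ∘ s_L` has the inverse `π_L ∘ S⁻¹ ∘ t_L`. -/
theorem IsHopfAlgebroid.theta_bijective (hS : IsHopfAlgebroid H S) :
    Function.Bijective (theta H S) := by
  have S_s : ∀ l, S (H.s l) = H.tt (theta H S l) := fun l => by
    have e := hS.S_mul (H.s l)
    rw [H.γ_src, antipodeMulL_tmul, mul_one] at e
    exact e
  have Sinv_t : ∀ l, S.symm (H.tt l) = H.s (H.π (S.symm (H.tt l))) := fun l => by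
    have e := hS.Sinv_mul (H.tt l)
    rw [H.γ_tgt] at e
    rw [← e]
    exact ((H.convT_tmul (T := S.symm.toAddMonoidHom) _ 1 (H.tt l)).trans (mul_one _)).symm
  refine Function.bijective_iff_has_inverse.mpr ⟨fun l => H.π (S.symm (H.tt l)), fun l => ?_,
    fun l => ?_⟩
  · show H.π (S.symm (H.tt (theta H S l))) = l
    rw [← S_s, S.symm_apply_apply, H.π_src]
  · show H.π (S (H.s (H.π (S.symm (H.tt l))))) = l
    rw [← Sinv_t, S.apply_symm_apply, H.π_tgt]

theorem IsHopfAlgebroid.luBase (hS : IsHopfAlgebroid H S) : LuBase H S where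
  anti := hS.anti
  S_t := hS.S_t
  S_mul := hS.S_mul
  theta_bij := hS.theta_bijective

/-- The Hopf algebroid axioms imply the Lu-style form. For the right bialgebroid transported
through `S`, the second axiom reads `β(S⁻¹(a¹) ⊗ a²) = 1 ⊗ a`, which gives the second mixed
coassociativity law; then `α(a¹ ⊗ S(a²)) = a ⊗ 1`, which gives the first one. The first axiom is
the same identity for the other candidate for `γ_R`, so the two candidates agree. -/
theorem IsHopfAlgebroid.isLuForm (hS : IsHopfAlgebroid H S) (μ : Lᵐᵒᵖ ≃+* R) :
    IsLuForm H S μ := by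
  have h := hS.luBase
  let G := h.rightBialgebroid μ
  have hG : SameBase H G := h.sameBase μ
  have hα := hS.alpha_bijective hG
  have hβ := hS.beta_bijective hG
  have hS' : ∀ r a, S (a * G.tt r) = G.s r * S a := h.S_mul_tR μ
  have hT' : ∀ r a, S.symm (a * G.s r) = G.tt r * S.symm a := fun r a => by
    have e : S (G.tt r) = G.s r := h.S_tgt μ r
    rw [anti_symm S h.anti, ← e, S.symm_apply_apply]
  have hb : ∀ a, hG.beta (G.idT S.symm.toAddMonoidHom hT' (G.γ a)) = Ten.tmul _ _ 1 a := by
    intro a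
    obtain ⟨a, rfl⟩ := S.surjective a
    have e₁ : G.γ (S a) = h.twist μ (H.γ a) := h.coprod_S μ a
    have e₂ := Ten.hom_ext
      (f := (hG.beta.comp (G.idT S.symm.toAddMonoidHom hT')).comp (h.twist μ))
      (g := axiomMapS H S (S_t_mul H S hS.anti hS.S_t))
      (fun x y => by
        rw [axiomMapS_tmul]
        refine (congrArg (fun z => hG.beta (G.idT S.symm.toAddMonoidHom hT' z))
          (h.twist_tmul μ x y)).trans ?_
        refine (congrArg hG.beta (G.idT_tmul (T := S.symm.toAddMonoidHom) hT' (S y) (S x))).trans ?_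
        refine (hG.beta_tmul _ _).trans ?_
        exact congrArg (fun u => H.mulR u 1 (H.γ (S x))) (S.symm_apply_apply y)) (H.γ a)
    rw [e₁]
    exact e₂.trans (hS.ax_S a)
  have mixed_RL := hG.mixedRL_of_beta hβ (T := S.symm) hT' hb
  have ha := hG.alpha_idS_of_surjective mixed_RL hα.2 (S_t_mul H S hS.anti hS.S_t) hS'
    (h.S_mul_of_convT μ hS.Sinv_mul)
  have mixed_LR := hG.mixedLR_of_alpha hα hS' ha
  refine { toLuBase := h, gammaR_eq := fun a => ?_, mixed_LR := mixed_LR, mixed_RL := mixed_RL }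
  have e₁ : hG.alpha (G.idS S.toAddMonoidHom hS' ((h.twistR μ).symm (H.γ (S a)))) =
      Ten.tmul _ _ a 1 := by
    have e := Ten.hom_ext
      (f := (hG.alpha.comp (G.idS S.toAddMonoidHom hS')).comp
        (h.twistR μ).symm.toAddMonoidHom)
      (g := axiomMapSinv H S (Sinv_s_mul H S hS.anti hS.S_t))
      (fun x y => by
        rw [axiomMapSinv_tmul]
        refine (congrArg hG.alpha
          (G.idS_tmul (S := S.toAddMonoidHom) hS' (S.symm y) (S.symm x))).trans ?_
        refine (hG.alpha_tmul _ _).trans ?_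
        exact congrArg (fun u => H.mulR 1 u (H.γ (S.symm y))) (S.apply_symm_apply x)) (H.γ (S a))
    refine e.trans ?_
    rw [hS.ax_Sinv, S.symm_apply_apply]
  have e₂ := hα.1 ((ha a).trans e₁.symm)
  exact Function.LeftInverse.injective (G.idSinv_idS hS') e₂

end HopfToLu

end BohmSzlachanyi

theorem mainTheorem2 {A L R : Type*} [Ring A] [Ring L] [Ring R] (μ : Lᵐᵒᵖ ≃+* R)
    (H : BohmSzlachanyi.LeftBialgebroid A L) :
    (∀ S : A ≃+ A,
      [BohmSzlachanyi.IsHopfAlgebroid H S,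
        BohmSzlachanyi.IsLuForm H S μ,
        ∃ G : BohmSzlachanyi.RightBialgebroid A R,
          BohmSzlachanyi.IsSymmetricForm H G S].TFAE) ∧
    (∀ G : BohmSzlachanyi.RightBialgebroid A R,
      (∃ S : A ≃+ A, BohmSzlachanyi.IsSymmetricForm H G S) ↔
        BohmSzlachanyi.IsGaloisForm H G) ∧
    [∃ S : A ≃+ A, BohmSzlachanyi.IsHopfAlgebroid H S,
      ∃ S : A ≃+ A, BohmSzlachanyi.IsLuForm H S μ,
      ∃ (G : BohmSzlachanyi.RightBialgebroid A R) (S : A ≃+ A),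
        BohmSzlachanyi.IsSymmetricForm H G S,
      ∃ G : BohmSzlachanyi.RightBialgebroid A R, BohmSzlachanyi.IsGaloisForm H G].TFAE ∧
    (∀ S : A ≃+ A, BohmSzlachanyi.IsHopfAlgebroid H S →
      BohmSzlachanyi.IsTimesHopfAlgebra H) := by
  refine ⟨fun S => ?_, fun G => ⟨fun ⟨_, hS⟩ => hS.isGaloisForm,
    fun hG => hG.exists_isSymmetricForm⟩, ?_, fun S hS => ?_⟩
  · tfae_have 1 → 2 := fun hS => hS.isLuForm μ
    tfae_have 2 → 3 := fun hS => ⟨_, hS.isSymmetricForm⟩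
    tfae_have 3 → 1 := fun ⟨_, hS⟩ => hS.isHopfAlgebroid
    tfae_finish
  · tfae_have 1 → 2 := fun ⟨S, hS⟩ => ⟨S, hS.isLuForm μ⟩
    tfae_have 2 → 3 := fun ⟨S, hS⟩ => ⟨_, S, hS.isSymmetricForm⟩
    tfae_have 3 → 4 := fun ⟨G, _, hS⟩ => ⟨G, hS.isGaloisForm⟩
    tfae_have 4 → 1 := fun ⟨_, hG⟩ =>
      let ⟨S, hS⟩ := hG.exists_isSymmetricForm
      ⟨S, hS.isHopfAlgebroid⟩
    tfae_finish
  · have hG := hS.luBase.sameBase μ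
    exact hG.galoisMap_bijective (hS.alpha_bijective hG)
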